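/- Let $N\ge 2$, let $\Omega\subset\mathbb R^N$ be a domain (open and connected), let $K\subset\mathbb R^N$ be a nonempty closed set and put $d(x)=\operatorname{dist}(x,K)$. Let $p>1$ and let $k$ be a real number with $k>2p$ (the main example is that $K$ is a closed piecewise smooth surface of codimension $k\in\{1,\dots,N\}$, but neither regularity of $K$ nor a relation of $k$ to the dimension of $K$ is assumed beyond the following). Suppose that $\sup_{x\in\Omega}d(x)<\infty$ and that $$d\,\Delta d-k+1\ge 0\quad\text{in }\Omega\setminus K$$ in the distributional sense, that is, $-\int_{\Omega\setminus K}\nabla d\cdot\nabla(d\varphi)\,dx-(k-1)\int_{\Omega\setminus K}\varphi\,dx\ge 0$ for all $0\le\varphi\in C_c^\infty(\Omega\setminus K)$. Define $X_1(t)=(1-\log t)^{-1}$ for $t\in(0,1]$ and $X_i(t)=X_1(X_{i-1}(t))$ for $i\ge 2$, and let $$Q=\frac{(p-1)k(k-2p)}{p^2}.$$ Then there is a constant $D_0>0$ with $D_0\ge\sup_{x\in\Omega}d(x)$ such that for every $D\ge D_0$ and every real-valued $u\in C_c^\infty(\Omega\setminus K)$, with $X_j=X_j(d(x)/D)$, the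 series below converges and $$\int_\Omega|\Delta u|^p\,dx\ \ge\ Q^p\int_\Omega\frac{|u|^p}{d^{2p}}\,dx+\frac{p-1}{2p^3}|Q|^{p-2}\Bigl\{k^2(p-1)^2+(k-2p)^2\Bigr\}\sum_{i=1}^\infty\int_\Omega\frac{|u|^p}{d^{2p}}X_1^2X_2^2\cdots X_i^2\,dx .$$ -/

import Mathlib

open MeasureTheory Laplacian
open scoped ContDiff

noncomputable section

namespace Rellich

/-- Membership in `C_c^∞(U)`, for an open set `U` of `ℝ^N` (real-valued functions, extended by zero
outside `U`). -/
structure IsTestFunction {N : ℕ} (U : Set (EuclideanSpace ℝ (Fin N)))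
    (φ : EuclideanSpace ℝ (Fin N) → ℝ) : Prop where
  contDiff : ContDiff ℝ ∞ φ
  hasCompactSupport : HasCompactSupport φ
  tsupport_subset : tsupport φ ⊆ U

/-- The pairing `⟨Δ f, ψ⟩ = - ∫_U ∇f · ∇ψ` of the distributional Laplacian of a Lipschitz function
`f` on `U` with a Lipschitz function `ψ` that has compact support in `U`. The gradients exist
almost everywhere by Rademacher's theorem. -/
def laplacianPairing {N : ℕ} (U : Set (EuclideanSpace ℝ (Fin N)))
    (f ψ : EuclideanSpace ℝ (Fin N) → ℝ) : ℝ :=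
  -∫ x in U, inner ℝ (gradient f x) (gradient ψ x)

/-- The inequality `d Δd - k + 1 ≥ 0` in the distributional sense in `U`, where
`d(x) = dist(x, K)`: the distribution `d Δd - k + 1` is nonnegative on nonnegative test functions.
The product of the Lipschitz function `d` and the distribution `Δd` is, as usual,
`⟨d Δd, φ⟩ = ⟨Δd, d φ⟩`. -/
def DistanceLaplacianBound {N : ℕ} (U K : Set (EuclideanSpace ℝ (Fin N))) (k : ℝ) : Prop :=
  ∀ φ : EuclideanSpace ℝ (Fin N) → ℝ, IsTestFunction U φ → (∀ x, 0 ≤ φ x) →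
    0 ≤ laplacianPairing U (fun x => Metric.infDist x K) (fun x => Metric.infDist x K * φ x)
      - (k - 1) * ∫ x in U, φ x

/-- The iterated logarithmic functions `X_1(t) = (1 - log t)⁻¹`, `X_{i+1}(t) = X_1(X_i(t))`, with
the convention `X_0(t) = t`. -/
def X : ℕ → ℝ → ℝ
  | 0, t => t
  | i + 1, t => (1 - Real.log (X i t))⁻¹

/-- `Q = (p - 1) k (k - 2p) / p²`. -/
def Q (p k : ℝ) : ℝ := (p - 1) * k * (k - 2 * p) / p ^ 2

/-- `G = (p - 1) / (2p³) |Q|^{p-2} (k² (p - 1)² + (k - 2p)²)`. -/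
def G (p k : ℝ) : ℝ :=
  (p - 1) / (2 * p ^ 3) * |Q p k| ^ (p - 2) * (k ^ 2 * (p - 1) ^ 2 + (k - 2 * p) ^ 2)

/-- `∫_Ω |u|^p d^{-2p} X_1² X_2² ⋯ X_i²`, where `d(x) = dist(x, K)` and `X_j = X_j(d(x)/D)`. -/
def logTerm {N : ℕ} (Ω K : Set (EuclideanSpace ℝ (Fin N))) (p D : ℝ)
    (u : EuclideanSpace ℝ (Fin N) → ℝ) (i : ℕ) : ℝ :=
  ∫ x in Ω, |u x| ^ p / Metric.infDist x K ^ (2 * p) *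
    ∏ j ∈ Finset.Icc 1 i, X j (Metric.infDist x K / D) ^ 2

end Rellich

end

/-!
The inequality is obtained by testing `-Δu` against `|u|^{p-2} u ψ(d)` with `ψ > 0`. Young's
inequality (`neg_mul_sub_le_abs_rpow`) gives
`∫ |Δu|^p ≥ -p ∫ ψ(d) |u|^{p-2} u Δu - (p-1) ∫ ψ(d)^{p/(p-1)} |u|^p`.
After an integration by parts, the first integral on the right contains the Dirichlet form
`(p-1) ∫ ψ(d) |u|^{p-2} |∇u|²`, which is bounded from below by completing a square with a vector
field `(A/ψ)(d) ∇d`, as in the proof of Hardy's inequality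
(`integral_mul_inner_sub_le_neg_integral_laplacian`; for `p < 2` the power `|u|^{p-2} u` is first
regularized). What remains, up to terms in `|u|^p`, is `∫ H(d) ∇d · ∇|u|^p` with
`H = 4(p-1)/p A + ψ'`. If `H ≤ 0`, the hypothesis `d Δd ≥ k - 1`, applied to the nonnegative
Lipschitz function `-H(d) |u|^p / d` (`DistanceLaplacianBound.of_lipschitz`, by mollification),
turns it into an integral of `|u|^p` as well. The outcome is `integral_mul_le_integral_abs_laplacian_rpow`: a lower
bound for `∫ |Δu|^p` by `∫ R(d) |u|^p`, with `R` explicit in terms of `ψ` and `A`.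

The functions are chosen as
`ψ(t) = Q^{p-1} t^{2-2p} (1 + β η)`, `A(t) = -Q^{p-1} t^{1-2p} (a₀ (1 + β η) + η/2 + a₂ η²)`, where
`η = X_1 + X_1 X_2 + ⋯ + X_1 ⋯ X_m` at `t/D` and `a₀ = (k-2p)/2`. Since
`t η' = (η² + b)/2` with `b = ∑ (X_1 ⋯ X_i)²`, the potential expands as
`R = t^{-2p} (Q^p + G b + O(η³))`: the terms linear in `η` cancel, and `β` is such that the
coefficient of `η²` vanishes, which is also what makes the constant `G` come out. The cubic
remainder is made nonnegative by a large `a₂`, because for small `t` the first summand dominates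
`η`, so that `b ≥ η²/4` (`sq_logSum_le`, `exists_profile`). The bound `η ≤ 2 / log (D/t)`
(`logSum_le`) does not involve `m`, so all of this holds for `d ≤ D e^{-Λ}` with `Λ` independent
of `m`. The partial sums of the series are therefore bounded, and `m → ∞` gives convergence and the
inequality, `G` being positive.
-/

open Filter Topology Set
open scoped Gradient Convolution NNReal

/-! ### Gradients, Green's formula and mollification of Lipschitz functions -/

/-- A bounded measurable function vanishing off a compact set is integrable. -/
lemma integrable_of_bounded_of_compact {E F : Type*} [TopologicalSpace E] [MeasurableSpace E]
    {μ : Measure E} [IsFiniteMeasureOnCompacts μ] [NormedAddCommGroup F] {f : E → F} {S : Set E}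
    (hS : IsCompact S)
    (hf : AEStronglyMeasurable f μ) (h0 : ∀ x, x ∉ S → f x = 0) {C : ℝ} (hC : ∀ᵐ x ∂μ, ‖f x‖ ≤ C) :
    Integrable f μ := by
  rw [← integrableOn_iff_integrable_of_support_subset (s := S)
    (fun x hx => by_contra fun h => hx (h0 x h))]
  exact Measure.integrableOn_of_bounded (M := C) hS.measure_lt_top.ne hf (ae_restrict_of_ae hC)

section Gradient

variable {E : Type*} [NormedAddCommGroup E] [InnerProductSpace ℝ E] [FiniteDimensional ℝ E]

lemma inner_gradient (f : E → ℝ) (x v : E) : inner ℝ (∇ f x) v = fderiv ℝ f x v := by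
  simp [gradient]

lemma norm_gradient_le_of_lipschitz {f : E → ℝ} {C : ℝ≥0} (hf : LipschitzWith C f) (x : E) :
    ‖∇ f x‖ ≤ C := by
  simpa [gradient] using norm_fderiv_le_of_lipschitz ℝ hf (x₀ := x)

lemma gradient_of_notMem_tsupport {f : E → ℝ} {x : E} (hx : x ∉ tsupport f) : ∇ f x = 0 := by
  simp [gradient, fderiv_of_notMem_tsupport ℝ hx]

lemma HasGradientAt.comp_real {f : E → ℝ} {f' x : E} {g : ℝ → ℝ} {g' : ℝ}
    (hg : HasDerivAt g g' (f x)) (hf : HasGradientAt f f' x) :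
    HasGradientAt (fun y => g (f y)) (g' • f') x := by
  rw [hasGradientAt_iff_hasFDerivAt] at hf ⊢
  have := hg.comp_hasFDerivAt x hf
  simpa [Function.comp_def] using this

lemma HasGradientAt.mul_real {f g : E → ℝ} {f' g' x : E} (hf : HasGradientAt f f' x)
    (hg : HasGradientAt g g' x) :
    HasGradientAt (fun y => f y * g y) (f x • g' + g x • f') x := by
  rw [hasGradientAt_iff_hasFDerivAt] at hf hg ⊢
  have := hf.mul hg
  rw [map_add, map_smul, map_smul]
  exact this

variable [MeasurableSpace E] [BorelSpace E]

lemma measurable_gradient (f : E → ℝ) : Measurable (∇ f) :=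
  ((InnerProductSpace.toDual ℝ E).symm.continuous.measurable).comp (measurable_fderiv ℝ f)

variable {μ : Measure E} [μ.IsAddHaarMeasure]

lemma LipschitzWith.ae_hasGradientAt {f : E → ℝ} {C : ℝ≥0} (hf : LipschitzWith C f) :
    ∀ᵐ x ∂μ, HasGradientAt f (∇ f x) x :=
  hf.ae_differentiableAt.mono fun _ hx => hx.hasGradientAt

/-- Green's formula for a smooth function and a Lipschitz function. -/
lemma integral_laplacian_mul_eq_neg {u w : E → ℝ} (hu : ContDiff ℝ 2 u) (hcu : HasCompactSupport u)
    {C : ℝ≥0} (hw : LipschitzWith C w) (hcw : HasCompactSupport w) :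
    ∫ x, (Δ u) x * w x ∂μ = -∫ x, inner ℝ (∇ u x) (∇ w x) ∂μ := by
  set e := stdOrthonormalBasis ℝ E
  have h1 : ∀ i, ContDiff ℝ 1 (fun x => fderiv ℝ u x (e i)) := fun i =>
    (hu.fderiv_right (m := 1) (by norm_num)).clm_apply contDiff_const
  have h2 : ∀ i, HasCompactSupport (fun x => fderiv ℝ u x (e i)) := fun i =>
    (hcu.fderiv ℝ).comp_left (g := fun L : E →L[ℝ] ℝ => L (e i)) (by simp)
  have hlin : ∀ i x, lineDeriv ℝ (fun x => fderiv ℝ u x (e i)) x (e i)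
      = iteratedFDeriv ℝ 2 u x ![e i, e i] := by
    intro i x
    have hd : Differentiable ℝ (fderiv ℝ u) :=
      (hu.fderiv_right (m := 1) (by norm_num)).differentiable (by norm_num)
    rw [((h1 i).differentiable (by norm_num) x).lineDeriv_eq_fderiv, iteratedFDeriv_two_apply,
      fderiv_clm_apply (hd x) (by fun_prop)]
    simp
  have h3 : ∀ i, ∫ x, iteratedFDeriv ℝ 2 u x ![e i, e i] * w x ∂μ
      = - ∫ x, inner ℝ (∇ u x) (e i) * inner ℝ (e i) (∇ w x) ∂μ := by
    intro i
    obtain ⟨D, hD⟩ := ContDiff.lipschitzWith_of_hasCompactSupport (h2 i) (h1 i) (by norm_num)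
    have := hD.integral_lineDeriv_mul_eq (μ := μ) hw hcw (e i)
    simp_rw [hlin] at this
    rw [this, ← integral_neg]
    refine integral_congr_ae (hw.ae_differentiableAt.mono fun x hx => ?_)
    simp only [hx.lineDeriv_eq_fderiv, map_neg]
    rw [inner_gradient, real_inner_comm (∇ w x), inner_gradient]
    ring
  have i1 : ∀ i, Integrable (fun x => iteratedFDeriv ℝ 2 u x ![e i, e i] * w x) μ := by
    intro i
    have hc : Continuous (fun x => iteratedFDeriv ℝ 2 u x ![e i, e i]) := by
      have h := hu.continuous_iteratedFDeriv (m := 2) le_rfl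
      fun_prop
    exact (hc.mul hw.continuous).integrable_of_hasCompactSupport hcw.mul_left
  obtain ⟨Cu, hCu⟩ := ContDiff.lipschitzWith_of_hasCompactSupport hcu hu (by norm_num)
  have i2 : ∀ i, Integrable (fun x => inner ℝ (∇ u x) (e i) * inner ℝ (e i) (∇ w x)) μ := by
    intro i
    refine integrable_of_bounded_of_compact (C := Cu * C) hcu ?_ ?_ ?_
    · have := measurable_gradient u
      have := measurable_gradient w
      exact Measurable.aestronglyMeasurable (by fun_prop)
    · intro x hx
      simp [gradient_of_notMem_tsupport hx]
    · refine Eventually.of_forall fun x => ?_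
      rw [norm_mul]
      have a1 := norm_inner_le_norm (𝕜 := ℝ) (∇ u x) (e i)
      have a2 := norm_inner_le_norm (𝕜 := ℝ) (e i) (∇ w x)
      have b1 := norm_gradient_le_of_lipschitz hCu x
      have b2 := norm_gradient_le_of_lipschitz hw x
      simp only [OrthonormalBasis.norm_eq_one, mul_one, one_mul] at a1 a2
      exact mul_le_mul (a1.trans b1) (a2.trans b2) (norm_nonneg _) (by positivity)
  calc ∫ x, (Δ u) x * w x ∂μ = ∫ x, ∑ i, iteratedFDeriv ℝ 2 u x ![e i, e i] * w x ∂μ := by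
        rw [InnerProductSpace.laplacian_eq_iteratedFDeriv_orthonormalBasis u e]
        simp [Finset.sum_mul]
    _ = - ∫ x, ∑ i, inner ℝ (∇ u x) (e i) * inner ℝ (e i) (∇ w x) ∂μ := by
        rw [integral_finsetSum _ fun i _ => i1 i, integral_finsetSum _ fun i _ => i2 i]
        simp [h3]
    _ = _ := by simp_rw [e.sum_inner_mul_inner]

/-- Mollification differentiates a Lipschitz function through its almost everywhere defined
derivative. -/
lemma hasFDerivAt_convolution_of_lipschitz {f w : E → ℝ} (hf : Continuous f)
    (hcf : HasCompactSupport f) {C : ℝ≥0} (hw : LipschitzWith C w) (x : E) :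
    HasFDerivAt (f ⋆[ContinuousLinearMap.lsmul ℝ ℝ, μ] w)
      ((f ⋆[ContinuousLinearMap.lsmul ℝ ℝ, μ] (fderiv ℝ w)) x) x := by
  simp only [MeasureTheory.convolution_def, ContinuousLinearMap.lsmul_apply]
  have hcw := hw.continuous
  refine (hasFDerivAt_integral_of_dominated_loc_of_lip (bound := fun t => |f t| * C)
    (s := univ) univ_mem ?_ ?_ ?_ ?_ ?_ ?_).2
  · exact Eventually.of_forall fun y => Continuous.aestronglyMeasurable (by fun_prop)
  · exact (Continuous.integrable_of_hasCompactSupport (by fun_prop) (hcf.smul_right))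
  · have h1 : Measurable (fun t => fderiv ℝ w (x - t)) :=
      (measurable_fderiv ℝ w).comp (by fun_prop)
    have h2 := hf.measurable
    exact Measurable.aestronglyMeasurable (by fun_prop)
  · refine Eventually.of_forall fun t => ?_
    refine LipschitzWith.lipschitzOnWith (LipschitzWith.of_dist_le_mul fun y z => ?_)
    have := hw.dist_le_mul (y - t) (z - t)
    change dist (f t * w (y - t)) (f t * w (z - t)) ≤ _
    rw [Real.dist_eq, ← mul_sub, abs_mul, Real.coe_nnabs, abs_mul, abs_abs,
      NNReal.abs_eq, mul_assoc]
    rw [Real.dist_eq, dist_sub_right] at this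
    exact mul_le_mul_of_nonneg_left this (abs_nonneg _)
  · exact (Continuous.integrable_of_hasCompactSupport hf.abs hcf.abs).mul_const _
  · have hae : ∀ᵐ t ∂μ, DifferentiableAt ℝ w (x - t) := by
      have h := hw.ae_differentiableAt (μ := μ)
      exact (quasiMeasurePreserving_sub_left_of_right_invariant μ x).ae h
    filter_upwards [hae] with t ht
    have : HasFDerivAt (fun y => w (y - t)) (fderiv ℝ w (x - t)) x := by
      have := ht.hasFDerivAt.comp x ((hasFDerivAt_id x).sub_const t)
      simpa [Function.comp_def] using this
    exact this.const_smul (f t)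

end Gradient

/-! ### The geometric hypothesis for Lipschitz test functions -/

section Mollification

variable {E : Type*} [NormedAddCommGroup E] [InnerProductSpace ℝ E] [FiniteDimensional ℝ E]
  [MeasurableSpace E] [BorelSpace E]

/-- A nonnegative Lipschitz function with compact support in an open set is a limit of nonnegative
test functions, in such a way that one can pass to the limit in integrals that are linear in the
function and its gradient. -/
lemma exists_mollification {U : Set E} (hU : IsOpen U) {w : E → ℝ} {C : ℝ≥0}
    (hw : LipschitzWith C w) (hcw : HasCompactSupport w) (hsupp : tsupport w ⊆ U)
    (h0 : ∀ x, 0 ≤ w x) (μ : Measure E) [μ.IsAddHaarMeasure] :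
    ∃ (S : Set E) (M : ℝ) (v : ℕ → E → ℝ), IsCompact S ∧ S ⊆ U ∧ tsupport w ⊆ S ∧
      (∀ n, ContDiff ℝ ∞ (v n)) ∧ (∀ n, tsupport (v n) ⊆ S) ∧ (∀ n x, 0 ≤ v n x) ∧
      (∀ n x, ‖v n x‖ ≤ M) ∧ (∀ n x, ‖∇ (v n) x‖ ≤ C) ∧
      (∀ x, Tendsto (fun n => v n x) atTop (𝓝 (w x))) ∧
      ∀ᵐ x ∂μ, Tendsto (fun n => ∇ (v n) x) atTop (𝓝 (∇ w x)) := by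
  obtain ⟨δ, hδ, hδU⟩ := hcw.isCompact.exists_cthickening_subset_open hU hsupp
  set S := Metric.cthickening δ (tsupport w)
  obtain ⟨M, hM⟩ := hw.continuous.bounded_above_of_compact_support hcw
  have hMm : AEStronglyMeasurable w μ := hw.continuous.aestronglyMeasurable
  let b : ℕ → ContDiffBump (0 : E) := fun n =>
    ⟨δ / (n + 1) / 2, δ / (n + 1), by positivity, half_lt_self (by positivity)⟩
  have hb : Tendsto (fun n => (b n).rOut) atTop (𝓝 0) := by
    simpa [b, div_eq_mul_inv] using
      (tendsto_one_div_add_atTop_nhds_zero_nat (𝕜 := ℝ)).const_mul δ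
  have hbδ : ∀ n, (b n).rOut ≤ δ := fun n => by
    simp only [b]
    exact div_le_self hδ.le (by linarith [(Nat.cast_nonneg n : (0 : ℝ) ≤ n)])
  have hb2 : ∀ n, (b n).rOut ≤ 2 * (b n).rIn := fun n => by simp only [b]; linarith
  let v : ℕ → E → ℝ := fun n => (b n).normed μ ⋆[ContinuousLinearMap.lsmul ℝ ℝ, μ] w
  have hder : ∀ n x, HasFDerivAt (v n) (((b n).normed μ ⋆[ContinuousLinearMap.lsmul ℝ ℝ, μ]
      (fderiv ℝ w)) x) x := fun n x =>
    hasFDerivAt_convolution_of_lipschitz (b n).continuous_normed (b n).hasCompactSupport_normed hw x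
  have hdm : AEStronglyMeasurable (fderiv ℝ w) μ := (measurable_fderiv ℝ w).aestronglyMeasurable
  have hdC : ∀ x, ‖fderiv ℝ w x‖ ≤ C := fun x => norm_fderiv_le_of_lipschitz ℝ hw
  have hzero : ∀ n x, x ∉ S → v n x = 0 := by
    intro n x hx
    simp only [v, MeasureTheory.convolution_def]
    refine integral_eq_zero_of_ae (Eventually.of_forall fun t => ?_)
    by_cases ht : t ∈ Metric.ball (0 : E) (b n).rOut
    · have : w (x - t) = 0 := by
        refine image_eq_zero_of_notMem_tsupport fun h => hx ?_
        refine Metric.mem_cthickening_of_dist_le x (x - t) δ _ h ?_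
        rw [mem_ball_zero_iff] at ht
        simpa [dist_eq_norm] using ht.le.trans (hbδ n)
      simp [this]
    · have : (b n).normed μ t = 0 := by
        rw [← Function.notMem_support, (b n).support_normed_eq]; exact ht
      simp [this]
  refine ⟨S, M, v, hcw.isCompact.cthickening, hδU, Metric.self_subset_cthickening _, ?_, ?_, ?_,
    ?_, ?_, ?_, ?_⟩
  · intro n
    exact (b n).hasCompactSupport_normed.contDiff_convolution_left _ (b n).contDiff_normed
      hw.continuous.locallyIntegrable
  · intro n
    refine closure_minimal (fun x hx => ?_) Metric.isClosed_cthickening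
    by_contra h
    exact hx (hzero n x h)
  · intro n x
    simp only [v, MeasureTheory.convolution_def]
    exact integral_nonneg fun t => mul_nonneg ((b n).nonneg_normed t) (h0 _)
  · intro n x
    rw [← dist_zero_right]
    exact dist_convolution_le ((norm_nonneg _).trans (hM x)) (b n).support_normed_eq.subset
      (b n).nonneg_normed (b n).integral_normed hMm (fun y _ => by simpa using hM y)
  · intro n x
    have : ‖∇ (v n) x‖ = ‖fderiv ℝ (v n) x‖ := by simp [gradient]
    rw [this, (hder n x).fderiv, ← dist_zero_right]
    exact dist_convolution_le C.2 (b n).support_normed_eq.subset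
      (b n).nonneg_normed (b n).integral_normed hdm (fun y _ => by simpa using hdC y)
  · intro x
    exact ContDiffBump.convolution_tendsto_right_of_continuous hb hw.continuous x
  · have hint : Integrable (fderiv ℝ w) μ :=
      integrable_of_bounded_of_compact hcw hdm
        (fun x hx => fderiv_of_notMem_tsupport ℝ hx) (Eventually.of_forall hdC)
    filter_upwards [ContDiffBump.ae_convolution_tendsto_right_of_locallyIntegrable hb
      (Eventually.of_forall hb2) hint.locallyIntegrable] with x hx
    simp only [gradient]
    refine ((InnerProductSpace.toDual ℝ E).symm.continuous.tendsto _).comp ?_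
    refine hx.congr fun n => (hder n x).fderiv.symm

end Mollification

namespace Rellich

/-- The geometric hypothesis extends from test functions to nonnegative Lipschitz functions with
compact support. -/
lemma DistanceLaplacianBound.of_lipschitz {N : ℕ} {U K : Set (EuclideanSpace ℝ (Fin N))} {k : ℝ}
    (hgeom : DistanceLaplacianBound U K k) (hU : IsOpen U) {w : EuclideanSpace ℝ (Fin N) → ℝ}
    {C : ℝ≥0} (hw : LipschitzWith C w) (hcw : HasCompactSupport w) (hsupp : tsupport w ⊆ U)
    (h0 : ∀ x, 0 ≤ w x) :
    0 ≤ laplacianPairing U (fun x => Metric.infDist x K) (fun x => Metric.infDist x K * w x)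
      - (k - 1) * ∫ x in U, w x := by
  obtain ⟨S, M, v, hS, hSU, hwS, hv1, hv2, hv3, hv4, hv5, hv6, hv7⟩ :=
    exists_mollification hU hw hcw hsupp h0 volume
  set d : EuclideanSpace ℝ (Fin N) → ℝ := fun x => Metric.infDist x K with hd
  have hdL : LipschitzWith 1 d := Metric.lipschitz_infDist_pt K
  obtain ⟨R, hR⟩ := hS.exists_bound_of_continuousOn hdL.continuous.continuousOn
  have hvz : ∀ n x, x ∉ S → v n x = 0 := fun n x hx =>
    image_eq_zero_of_notMem_tsupport fun h => hx (hv2 n h)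
  have hgz : ∀ n x, x ∉ S → ∇ (v n) x = 0 := fun n x hx =>
    gradient_of_notMem_tsupport fun h => hx (hv2 n h)
  have hSfin : volume S ≠ ⊤ := hS.measure_lt_top.ne
  have key : ∀ n, 0 ≤ laplacianPairing U d (fun x => d x * v n x)
      - (k - 1) * ∫ x in U, v n x := fun n =>
    hgeom (v n) ⟨hv1 n, hS.of_isClosed_subset (isClosed_tsupport _) (hv2 n),
      (hv2 n).trans hSU⟩ (hv3 n)
  have hgrad : ∀ (f : EuclideanSpace ℝ (Fin N) → ℝ), (∀ᵐ x, HasGradientAt f (∇ f x) x) →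
      ∀ᵐ x, ∇ (fun x => d x * f x) x = d x • ∇ f x + f x • ∇ d x := by
    intro f hf
    filter_upwards [hf, hdL.ae_hasGradientAt (μ := volume)] with x h1 h2
    exact (h2.mul_real h1).gradient
  have hgradv : ∀ᵐ x, ∀ n, ∇ (fun x => d x * v n x) x = d x • ∇ (v n) x + v n x • ∇ d x :=
    ae_all_iff.2 fun n => hgrad (v n) (Eventually.of_forall fun x =>
      (((hv1 n).differentiable (by simp)) x).hasGradientAt)
  have hgradw := hgrad w hw.ae_hasGradientAt
  have hlim1 : Tendsto (fun n => ∫ x in U, v n x) atTop (𝓝 (∫ x in U, w x)) := by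
    refine tendsto_integral_of_dominated_convergence (S.indicator fun _ => M) ?_ ?_ ?_ ?_
    · exact fun n => (hv1 n).continuous.aestronglyMeasurable
    · exact ((integrable_indicator_iff hS.measurableSet).2
        (integrableOn_const hSfin)).restrict
    · refine fun n => Eventually.of_forall fun x => ?_
      by_cases hx : x ∈ S
      · simpa [hx] using hv4 n x
      · simp [hx, hvz n x hx]
    · exact Eventually.of_forall hv6
  have hlim2 : Tendsto (fun n => ∫ x in U, inner ℝ (∇ d x) (∇ (fun x => d x * v n x) x)) atTop
      (𝓝 (∫ x in U, inner ℝ (∇ d x) (∇ (fun x => d x * w x) x))) := by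
    refine tendsto_integral_of_dominated_convergence (S.indicator fun _ => R * C + M) ?_ ?_ ?_ ?_
    · intro n
      have := measurable_gradient d
      have := measurable_gradient (fun x => d x * v n x)
      exact Measurable.aestronglyMeasurable (by fun_prop)
    · exact ((integrable_indicator_iff hS.measurableSet).2
        (integrableOn_const hSfin)).restrict
    · refine fun n => ae_restrict_of_ae (hgradv.mono fun x hx => ?_)
      rw [hx n]
      by_cases hxS : x ∈ S
      · rw [indicator_of_mem hxS]
        have h1 : ‖∇ d x‖ ≤ 1 := norm_gradient_le_of_lipschitz hdL x
        have hR0 : 0 ≤ R := (norm_nonneg _).trans (hR x hxS)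
        have h2 : ‖d x • ∇ (v n) x + v n x • ∇ d x‖ ≤ R * C + M := by
          refine (norm_add_le _ _).trans (add_le_add ?_ ?_)
          · rw [norm_smul]
            exact mul_le_mul (hR x hxS) (hv5 n x) (norm_nonneg _) hR0
          · rw [norm_smul]
            exact (mul_le_of_le_one_right (norm_nonneg _) h1).trans (hv4 n x)
        refine (norm_inner_le_norm _ _).trans ?_
        exact (mul_le_of_le_one_left (norm_nonneg _) h1).trans h2
      · simp [hxS, hvz n x hxS, hgz n x hxS]
    · refine ae_restrict_of_ae ?_
      filter_upwards [hgradv, hgradw, hv7] with x h1 h2 h3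
      simp only [h1, h2]
      exact tendsto_const_nhds.inner ((h3.const_smul _).add ((hv6 x).smul_const _))
  exact ge_of_tendsto' ((hlim2.neg).sub (hlim1.const_mul (k - 1))) key

end Rellich

/-! ### Functions of the distance and a regularized power -/

section Weight

variable {E : Type*} {d : E → ℝ} {a b : ℝ} {S : Set E} {c : ℝ → ℝ} {f : E → ℝ}

/-- On the support of `f` the argument of `c` may be clamped to `[a, b]`; this replaces a function
that is only continuous on `[a, b]` by one that is continuous everywhere. -/
lemma comp_mul_eq_comp_projIcc_mul (hab : a ≤ b) (hS : ∀ x ∈ S, d x ∈ Icc a b)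
    (h0 : ∀ x, x ∉ S → f x = 0) (x : E) :
    c (d x) * f x = c (projIcc a b hab (d x)) * f x := by
  by_cases hx : x ∈ S
  · rw [projIcc_of_mem hab (hS x hx)]
  · simp [h0 x hx]

lemma continuous_comp_projIcc (hab : a ≤ b) (hc : ContinuousOn c (Icc a b)) :
    Continuous fun t => c (projIcc a b hab t) :=
  hc.comp_continuous (continuous_subtype_val.comp continuous_projIcc) fun t => (projIcc a b hab t).2

lemma exists_forall_abs_comp_projIcc_le (hab : a ≤ b) (hc : ContinuousOn c (Icc a b)) :
    ∃ B, 0 ≤ B ∧ ∀ t, |c (projIcc a b hab t)| ≤ B := by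
  obtain ⟨B, hB⟩ := isCompact_Icc.exists_bound_of_continuousOn hc
  exact ⟨B, (norm_nonneg _).trans (hB a (left_mem_Icc.2 hab)), fun t => hB _ (projIcc a b hab t).2⟩

section Integral

variable [TopologicalSpace E] [MeasurableSpace E] [BorelSpace E] {μ : Measure E}
  [IsFiniteMeasureOnCompacts μ]

lemma integrable_comp_mul (hab : a ≤ b) (hd : Continuous d) (hSc : IsCompact S)
    (hS : ∀ x ∈ S, d x ∈ Icc a b) (hc : ContinuousOn c (Icc a b)) (h0 : ∀ x, x ∉ S → f x = 0)
    (hf : Measurable f) {M : ℝ} (hM : ∀ x, |f x| ≤ M) :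
    Integrable (fun x => c (d x) * f x) μ := by
  simp_rw [comp_mul_eq_comp_projIcc_mul hab hS h0]
  obtain ⟨B, hB0, hB⟩ := exists_forall_abs_comp_projIcc_le hab hc
  have hm := ((continuous_comp_projIcc hab hc).comp hd).measurable
  refine integrable_of_bounded_of_compact (C := B * M) hSc (hm.mul hf).aestronglyMeasurable
    (fun x hx => by simp [h0 x hx]) (Eventually.of_forall fun x => ?_)
  rw [Real.norm_eq_abs, abs_mul]
  exact mul_le_mul (hB _) (hM x) (abs_nonneg _) hB0

lemma tendsto_integral_comp_mul (hab : a ≤ b) (hd : Continuous d) (hSc : IsCompact S)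
    (hSm : MeasurableSet S)
    (hS : ∀ x ∈ S, d x ∈ Icc a b) (hc : ContinuousOn c (Icc a b)) {F : ℕ → E → ℝ}
    (h0 : ∀ n x, x ∉ S → F n x = 0) (hF : ∀ n, Measurable (F n)) {M : ℝ} (hM : ∀ n x, |F n x| ≤ M)
    (hlim : ∀ x, Tendsto (fun n => F n x) atTop (𝓝 (f x))) :
    Tendsto (fun n => ∫ x, c (d x) * F n x ∂μ) atTop (𝓝 (∫ x, c (d x) * f x ∂μ)) := by
  have hf0 : ∀ x, x ∉ S → f x = 0 := fun x hx =>
    tendsto_nhds_unique (hlim x) (by simp [h0 _ x hx])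
  simp_rw [comp_mul_eq_comp_projIcc_mul hab hS hf0,
    fun n x => comp_mul_eq_comp_projIcc_mul (c := c) hab hS (h0 n) x]
  obtain ⟨B, hB0, hB⟩ := exists_forall_abs_comp_projIcc_le hab hc
  have hm := ((continuous_comp_projIcc hab hc).comp hd).measurable
  refine tendsto_integral_of_dominated_convergence (S.indicator fun _ => B * M)
    (fun n => (hm.mul (hF n)).aestronglyMeasurable)
    ((integrable_indicator_iff hSm).2 (integrableOn_const hSc.measure_lt_top.ne))
    (fun n => Eventually.of_forall fun x => ?_)
    (Eventually.of_forall fun x => (hlim x).const_mul _)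
  by_cases hx : x ∈ S
  · rw [indicator_of_mem hx, Real.norm_eq_abs, abs_mul]
    exact mul_le_mul (hB _) (hM n x) (abs_nonneg _) hB0
  · simp [hx, h0 n x hx]

end Integral

lemma exists_lipschitzWith_mul_comp [NormedAddCommGroup E] (hab : a ≤ b)
    (hd : LipschitzWith 1 d) {C : ℝ≥0} (hf : LipschitzWith C f) (hcf : HasCompactSupport f)
    (hS : ∀ x ∈ tsupport f, d x ∈ Icc a b)
    {c' : ℝ → ℝ} (hc : ∀ t ∈ Icc a b, HasDerivAt c (c' t) t) (hc' : ContinuousOn c' (Icc a b)) :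
    ∃ D, LipschitzWith D fun x => f x * c (d x) := by
  have hcc : ContinuousOn c (Icc a b) := fun t ht => (hc t ht).continuousAt.continuousWithinAt
  obtain ⟨B, hB0, hB⟩ := exists_forall_abs_comp_projIcc_le hab hcc
  obtain ⟨L, hL⟩ := isCompact_Icc.exists_bound_of_continuousOn hc'
  have hL0 : 0 ≤ L := (norm_nonneg _).trans (hL a (left_mem_Icc.2 hab))
  obtain ⟨M, hM⟩ := hf.continuous.bounded_above_of_compact_support hcf
  have hM0 : 0 ≤ M := (norm_nonneg _).trans (hM 0)
  have hlip : LipschitzOnWith ⟨L, hL0⟩ c (Icc a b) :=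
    (convex_Icc a b).lipschitzOnWith_of_nnnorm_hasDerivWithin_le
      (fun t ht => (hc t ht).hasDerivWithinAt) hL
  have hlip2 : ∀ s t, |c (projIcc a b hab s) - c (projIcc a b hab t)| ≤ L * |s - t| := by
    intro s t
    have h1 := hlip.dist_le_mul _ (projIcc a b hab s).2 _ (projIcc a b hab t).2
    have h2 := (LipschitzWith.projIcc hab).dist_le_mul s t
    rw [Real.dist_eq] at h1
    refine h1.trans (mul_le_mul_of_nonneg_left ?_ hL0)
    rw [Subtype.dist_eq] at h2
    simpa [Real.dist_eq] using h2
  refine ⟨⟨M * L + B * C, by positivity⟩, LipschitzWith.of_dist_le_mul fun x y => ?_⟩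
  have e : ∀ x, f x * c (d x) = f x * c (projIcc a b hab (d x)) := fun x => by
    rw [mul_comm, comp_mul_eq_comp_projIcc_mul hab hS
      (fun x hx => image_eq_zero_of_notMem_tsupport hx), mul_comm]
  rw [e x, e y, Real.dist_eq]
  set g := fun x => c (projIcc a b hab (d x)) with hg
  have h1 : |g x - g y| ≤ L * dist x y := by
    refine (hlip2 _ _).trans (mul_le_mul_of_nonneg_left ?_ hL0)
    simpa [Real.dist_eq] using hd.dist_le_mul x y
  have h2 : |f x - f y| ≤ C * dist x y := by simpa [Real.dist_eq] using hf.dist_le_mul x y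
  have h3 : f x * g x - f y * g y = f x * (g x - g y) + g y * (f x - f y) := by ring
  calc |f x * g x - f y * g y| ≤ |f x| * |g x - g y| + |g y| * |f x - f y| := by
        rw [h3, ← abs_mul, ← abs_mul]; exact abs_add_le _ _
    _ ≤ M * (L * dist x y) + B * (C * dist x y) := by
        gcongr
        · exact hM x
        · exact hB _
    _ = _ := by
      change _ = (M * L + B * C) * dist x y
      ring

variable [NormedAddCommGroup E] [InnerProductSpace ℝ E] [FiniteDimensional ℝ E]

lemma gradient_mul_comp {x : E} (hf : HasGradientAt f (∇ f x) x) (hd : HasGradientAt d (∇ d x) x)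
    (hS : ∀ x ∈ tsupport f, d x ∈ Icc a b)
    {c' : ℝ → ℝ} (hc : ∀ t ∈ Icc a b, HasDerivAt c (c' t) t) :
    ∇ (fun x => f x * c (d x)) x = c (d x) • ∇ f x + (f x * c' (d x)) • ∇ d x := by
  by_cases hx : x ∈ tsupport f
  · rw [(hf.mul_real (hd.comp_real (hc _ (hS x hx)))).gradient, smul_smul, add_comm]
  · have : x ∉ tsupport (fun x => f x * c (d x)) := fun h => hx (tsupport_mul_subset_left h)
    simp [gradient_of_notMem_tsupport this, gradient_of_notMem_tsupport hx,
      image_eq_zero_of_notMem_tsupport hx]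

end Weight

section RegularizedPower

/-- The smooth regularization `(s² + ε²)^{(p-2)/2} s` of the function `|s|^{p-2} s`, which is not
differentiable at `0` when `p < 2`. -/
noncomputable def regPow (p ε s : ℝ) : ℝ := (s ^ 2 + ε ^ 2) ^ ((p - 2) / 2) * s

/-- The derivative of `regPow p ε`. -/
noncomputable def regPowDeriv (p ε s : ℝ) : ℝ :=
  (s ^ 2 + ε ^ 2) ^ (p / 2 - 2) * ((p - 1) * s ^ 2 + ε ^ 2)

/-- The quotient `regPow² / regPowDeriv`, a regularization of `|s|^p / (p - 1)`. -/
noncomputable def regPowQuot (p ε s : ℝ) : ℝ :=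
  (s ^ 2 + ε ^ 2) ^ (p / 2) * s ^ 2 / ((p - 1) * s ^ 2 + ε ^ 2)

variable {p ε : ℝ} (s : ℝ)

lemma hasDerivAt_regPow (hε : 0 < ε) : HasDerivAt (regPow p ε) (regPowDeriv p ε s) s := by
  have hq : 0 < s ^ 2 + ε ^ 2 := by positivity
  have h1 : HasDerivAt (fun s : ℝ => s ^ 2 + ε ^ 2) (2 * s) s := by
    simpa using (hasDerivAt_pow 2 s).add_const (ε ^ 2)
  have h2 := (h1.rpow_const (p := (p - 2) / 2) (Or.inl hq.ne')).mul (hasDerivAt_id s)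
  refine h2.congr_deriv ?_
  have e1 : (s ^ 2 + ε ^ 2) ^ ((p - 2) / 2) = (s ^ 2 + ε ^ 2) ^ (p / 2 - 2) * (s ^ 2 + ε ^ 2) := by
    rw [← Real.rpow_add_one hq.ne']; ring_nf
  have e2 : (p - 2) / 2 - 1 = p / 2 - 2 := by ring
  rw [regPowDeriv, e1, e2]
  simp only [id]
  ring

lemma contDiff_regPow (hε : 0 < ε) : ContDiff ℝ 1 (regPow p ε) := by
  unfold regPow
  refine ContDiff.mul (ContDiff.rpow_const_of_ne (by fun_prop) fun s => ?_) contDiff_id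
  positivity

lemma regPowDeriv_pos (hp : 1 < p) (hε : 0 < ε) : 0 < regPowDeriv p ε s := by
  have : 0 < p - 1 := by linarith
  unfold regPowDeriv
  positivity

lemma regPowQuot_mul_regPowDeriv (hp : 1 < p) (hε : 0 < ε) :
    regPowQuot p ε s * regPowDeriv p ε s = regPow p ε s ^ 2 := by
  have h1 : 0 < p - 1 := by linarith
  have hq : 0 < s ^ 2 + ε ^ 2 := by positivity
  have hr : (p - 1) * s ^ 2 + ε ^ 2 ≠ 0 := by positivity
  have e : (s ^ 2 + ε ^ 2) ^ (p / 2) * (s ^ 2 + ε ^ 2) ^ (p / 2 - 2)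
      = ((s ^ 2 + ε ^ 2) ^ ((p - 2) / 2)) ^ 2 := by
    rw [← Real.rpow_add hq, ← Real.rpow_mul_natCast hq.le]
    congr 1; push_cast; ring
  unfold regPowQuot regPowDeriv regPow
  rw [mul_pow, ← e]
  field_simp

lemma abs_regPow_le (hp : 1 < p) (hε : 0 < ε) (hε1 : ε ≤ 1) :
    |regPow p ε s| ≤ (s ^ 2 + 1) ^ ((p - 1) / 2) := by
  have hq : 0 < s ^ 2 + ε ^ 2 := by positivity
  have h1 : |s| ≤ (s ^ 2 + ε ^ 2) ^ (1 / 2 : ℝ) := by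
    rw [← Real.sqrt_eq_rpow]
    exact Real.abs_le_sqrt (by nlinarith)
  rw [regPow, abs_mul, abs_of_pos (Real.rpow_pos_of_pos hq _)]
  calc _ ≤ (s ^ 2 + ε ^ 2) ^ ((p - 2) / 2) * (s ^ 2 + ε ^ 2) ^ (1 / 2 : ℝ) := by gcongr
    _ = (s ^ 2 + ε ^ 2) ^ ((p - 1) / 2) := by rw [← Real.rpow_add hq]; congr 1; ring
    _ ≤ _ := Real.rpow_le_rpow hq.le (by nlinarith) (by linarith)

lemma regPowQuot_nonneg (hp : 1 < p) : 0 ≤ regPowQuot p ε s := by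
  have : 0 < p - 1 := by linarith
  unfold regPowQuot
  positivity

lemma regPowQuot_le (hp : 1 < p) (hε : 0 < ε) (hε1 : ε ≤ 1) :
    regPowQuot p ε s ≤ (s ^ 2 + 1) ^ (p / 2) / (p - 1) := by
  have h1 : 0 < p - 1 := by linarith
  have hq : 0 < s ^ 2 + ε ^ 2 := by positivity
  have h2 : s ^ 2 / ((p - 1) * s ^ 2 + ε ^ 2) ≤ 1 / (p - 1) := by
    rw [div_le_div_iff₀ (by positivity) h1]
    nlinarith
  rw [regPowQuot, mul_div_assoc, div_eq_mul_one_div ((s ^ 2 + 1) ^ (p / 2))]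
  refine mul_le_mul ?_ h2 (by positivity) (by positivity)
  exact Real.rpow_le_rpow hq.le (by nlinarith) (by linarith)

lemma tendsto_regPow {e : ℕ → ℝ} (he : Tendsto e atTop (𝓝 0)) :
    Tendsto (fun n => regPow p (e n) s) atTop (𝓝 (|s| ^ (p - 2) * s)) := by
  rcases eq_or_ne s 0 with rfl | hs
  · simp [regPow]
  · have h : Tendsto (fun n => s ^ 2 + e n ^ 2) atTop (𝓝 (s ^ 2)) := by
      simpa using (he.pow 2).const_add (s ^ 2)
    have h2 := (h.rpow_const (p := (p - 2) / 2) (Or.inl (by positivity))).mul_const s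
    have : (s ^ 2) ^ ((p - 2) / 2) = |s| ^ (p - 2) := by
      rw [← sq_abs, ← Real.rpow_natCast, ← Real.rpow_mul (abs_nonneg s)]
      congr 1; push_cast; ring
    rwa [this] at h2

lemma tendsto_regPowQuot (hp : 1 < p) {e : ℕ → ℝ} (he : Tendsto e atTop (𝓝 0)) :
    Tendsto (fun n => regPowQuot p (e n) s) atTop (𝓝 (|s| ^ p / (p - 1))) := by
  have hp1 : 0 < p - 1 := by linarith
  rcases eq_or_ne s 0 with rfl | hs
  · simp [regPowQuot, Real.zero_rpow (by linarith : p ≠ 0)]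
  · have h : Tendsto (fun n => s ^ 2 + e n ^ 2) atTop (𝓝 (s ^ 2)) := by
      simpa using (he.pow 2).const_add (s ^ 2)
    have h' : Tendsto (fun n => (p - 1) * s ^ 2 + e n ^ 2) atTop (𝓝 ((p - 1) * s ^ 2)) := by
      simpa using (he.pow 2).const_add ((p - 1) * s ^ 2)
    have h2 := ((h.rpow_const (p := p / 2) (Or.inl (by positivity))).mul_const (s ^ 2)).div h'
      (by positivity)
    have : (s ^ 2) ^ (p / 2) = |s| ^ p := by
      rw [← sq_abs, ← Real.rpow_natCast, ← Real.rpow_mul (abs_nonneg s)]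
      congr 1; push_cast; ring
    rw [this] at h2
    rw [mul_div_mul_right _ _ (by positivity)] at h2
    exact h2

end RegularizedPower

/-! ### The integral inequality for a pair of one-variable functions -/

section WeightedInequality

variable {E : Type*} [NormedAddCommGroup E] [InnerProductSpace ℝ E] [FiniteDimensional ℝ E]

lemma continuous_laplacian {u : E → ℝ} (hu : ContDiff ℝ 2 u) : Continuous (Δ u) := by
  rw [InnerProductSpace.laplacian_eq_iteratedFDeriv_stdOrthonormalBasis]
  have h := hu.continuous_iteratedFDeriv (m := 2) le_rfl
  fun_prop

lemma laplacian_of_notMem_tsupport {u : E → ℝ} {x : E} (hx : x ∉ tsupport u) : (Δ u) x = 0 := by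
  have h : u =ᶠ[𝓝 x] fun _ => (0 : ℝ) := notMem_tsupport_iff_eventuallyEq.1 hx
  rw [InnerProductSpace.laplacian_congr_nhds h |>.eq_of_nhds]
  simp

/-- The weighted Young inequality that bounds `|a|^p` from below. -/
lemma neg_mul_sub_le_abs_rpow {p : ℝ} (hp : 1 < p) {c : ℝ} (hc : 0 < c) (y s : ℝ) :
    -(p * (c * (y * (|s| ^ (p - 2) * s)))) - (p - 1) * c ^ (p / (p - 1)) * |s| ^ p ≤ |y| ^ p := by
  have hp1 : 0 < p - 1 := by linarith
  have hs : |(|s| ^ (p - 2) * s)| = |s| ^ (p - 1) := by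
    rcases eq_or_ne s 0 with rfl | h
    · simp [Real.zero_rpow hp1.ne']
    · rw [abs_mul, abs_of_nonneg (by positivity), ← Real.rpow_add_one (abs_pos.2 h).ne']
      congr 1; ring
  have hy := Real.young_inequality_of_nonneg (abs_nonneg y)
    (b := c * |s| ^ (p - 1)) (by positivity) (Real.HolderConjugate.conjExponent hp)
  have e : (c * |s| ^ (p - 1)) ^ p.conjExponent = c ^ (p / (p - 1)) * |s| ^ p := by
    rw [Real.conjExponent, Real.mul_rpow hc.le (by positivity), ← Real.rpow_mul (abs_nonneg s)]
    congr 2; field_simp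
  rw [e, Real.conjExponent] at hy
  have h1 : -(c * (y * (|s| ^ (p - 2) * s))) ≤ |y| * (c * |s| ^ (p - 1)) := by
    rw [← hs]
    calc _ ≤ |c * (y * (|s| ^ (p - 2) * s))| := neg_le_abs _
      _ = _ := by rw [abs_mul, abs_mul, abs_of_pos hc]; ring
  have h2 : |y| ^ p / p + c ^ (p / (p - 1)) * |s| ^ p / (p / (p - 1))
      = (|y| ^ p + (p - 1) * (c ^ (p / (p - 1)) * |s| ^ p)) / p := by
    field_simp
  rw [h2] at hy
  have := (le_div_iff₀ (by linarith : 0 < p)).1 (h1.trans hy)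
  nlinarith

/-- The quadratic form estimate behind the Hardy inequality: `|e| ≤ 1`, `q = j² / j'`. -/
lemma mul_inner_sub_le {E : Type*} [NormedAddCommGroup E] [InnerProductSpace ℝ E] {G e : E}
    (he : ‖e‖ ≤ 1) {c j j' q A α : ℝ} (hc : 0 < c) (hj' : 0 < j') (hq : q * j' = j ^ 2) :
    2 * α * A * (j * inner ℝ G e) - α ^ 2 * (A ^ 2 / c * q) ≤ c * (j' * ‖G‖ ^ 2) := by
  have h1 : |inner ℝ G e| ≤ ‖G‖ :=
    (abs_real_inner_le_norm G e).trans (mul_le_of_le_one_right (norm_nonneg _) he)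
  have h2 : (inner ℝ G e : ℝ) ^ 2 ≤ ‖G‖ ^ 2 := sq_le_sq' (neg_le_of_abs_le h1) (le_of_abs_le h1)
  have hqe : q = j ^ 2 / j' := by field_simp; exact hq
  have h3 : 0 ≤ (c * j' * inner ℝ G e - α * A * j) ^ 2 / (c * j') := by positivity
  have h4 : (c * j' * inner ℝ G e - α * A * j) ^ 2 / (c * j')
      = c * j' * (inner ℝ G e) ^ 2 - 2 * α * A * (j * inner ℝ G e)
        + α ^ 2 * (A ^ 2 / c * q) := by
    rw [hqe]; field_simp; ring
  have h5 : c * j' * (inner ℝ G e : ℝ) ^ 2 ≤ c * j' * ‖G‖ ^ 2 :=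
    mul_le_mul_of_nonneg_left h2 (by positivity)
  nlinarith

variable [MeasurableSpace E] [BorelSpace E] (μ : Measure E) [μ.IsAddHaarMeasure]

/-- Testing `-Δ u` against `|u|^{p-2} u ψ(d)` and bounding the resulting Dirichlet form from below
by means of the vector field `(A / ψ)(d) ∇d`, whose length is at most `|A / ψ|(d)`. -/
theorem integral_mul_inner_sub_le_neg_integral_laplacian {p : ℝ} (hp : 1 < p) {u d : E → ℝ}
    (hu : ContDiff ℝ 2 u) (hcu : HasCompactSupport u) (hd : LipschitzWith 1 d) {a b : ℝ}
    (hab : a ≤ b) (hS : ∀ x ∈ tsupport u, d x ∈ Icc a b) {ψ ψ' A H : ℝ → ℝ}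
    (hψ : ∀ t ∈ Icc a b, HasDerivAt ψ (ψ' t) t) (hψ0 : ∀ t ∈ Icc a b, 0 < ψ t)
    (hψ' : ContinuousOn ψ' (Icc a b)) (hA : ContinuousOn A (Icc a b)) {α : ℝ}
    (hH : ∀ t, H t = 2 * α * A t + ψ' t) :
    ∫ x, H (d x) * (|u x| ^ (p - 2) * u x * inner ℝ (∇ u x) (∇ d x)) ∂μ
      - α ^ 2 * ∫ x, A (d x) ^ 2 / ψ (d x) * (|u x| ^ p / (p - 1)) ∂μ
      ≤ -∫ x, ψ (d x) * ((Δ u) x * (|u x| ^ (p - 2) * u x)) ∂μ := by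
  have hψc : ContinuousOn ψ (Icc a b) := fun t ht => (hψ t ht).continuousAt.continuousWithinAt
  have hHc : ContinuousOn H (Icc a b) := by
    rw [funext hH]; exact (continuousOn_const.mul hA).add hψ'
  have hRc : ContinuousOn (fun t => A t ^ 2 / ψ t) (Icc a b) :=
    (hA.pow 2).div hψc fun t ht => (hψ0 t ht).ne'
  have hu1 : ContDiff ℝ 1 u := hu.of_le (by norm_num)
  obtain ⟨Cu, hCu⟩ := ContDiff.lipschitzWith_of_hasCompactSupport hcu hu1 (by norm_num)
  obtain ⟨Mu, hMu⟩ := hu.continuous.bounded_above_of_compact_support hcu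
  have hΔc := continuous_laplacian hu
  have hΔs : HasCompactSupport (Δ u) :=
    HasCompactSupport.intro hcu fun x hx => laplacian_of_notMem_tsupport hx
  obtain ⟨ML, hML⟩ := hΔc.bounded_above_of_compact_support hΔs
  have hMu2 : ∀ x, u x ^ 2 ≤ Mu ^ 2 := fun x => by
    rw [← sq_abs]; exact pow_le_pow_left₀ (abs_nonneg _) (hMu x) 2
  have hu0 : ∀ x, x ∉ tsupport u → u x = 0 := fun x hx => image_eq_zero_of_notMem_tsupport hx
  have hgd : ∀ x, ‖∇ d x‖ ≤ 1 := norm_gradient_le_of_lipschitz hd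
  have hgu : ∀ x, ‖∇ u x‖ ≤ Cu := norm_gradient_le_of_lipschitz hCu
  have hin : ∀ x, |inner ℝ (∇ u x) (∇ d x)| ≤ (Cu : ℝ) := fun x =>
    (abs_real_inner_le_norm _ _).trans ((mul_le_of_le_one_right (norm_nonneg _) (hgd x)).trans
      (hgu x))
  have mgu := measurable_gradient u
  have mgd := measurable_gradient d
  set S := tsupport u with hSdef
  have hSc : IsCompact S := hcu
  have hSm : MeasurableSet S := (isClosed_tsupport u).measurableSet
  let e : ℕ → ℝ := fun n => 1 / ((n : ℝ) + 1)
  have he0 : ∀ n, 0 < e n := fun n => by positivity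
  have he1 : ∀ n, e n ≤ 1 := fun n => by
    simp only [e]
    rw [div_le_one (by positivity)]
    linarith [(Nat.cast_nonneg n : (0 : ℝ) ≤ n)]
  have he : Tendsto e atTop (𝓝 0) := tendsto_one_div_add_atTop_nhds_zero_nat
  set Bj := (Mu ^ 2 + 1) ^ ((p - 1) / 2)
  have hBj : ∀ n x, |regPow p (e n) (u x)| ≤ Bj := fun n x =>
    (abs_regPow_le (u x) hp (he0 n) (he1 n)).trans
      (Real.rpow_le_rpow (by positivity) (by linarith [hMu2 x]) (by linarith))
  set Bq := (Mu ^ 2 + 1) ^ (p / 2) / (p - 1)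
  have hBq : ∀ n x, |regPowQuot p (e n) (u x)| ≤ Bq := fun n x => by
    rw [abs_of_nonneg (regPowQuot_nonneg _ hp)]
    refine (regPowQuot_le (u x) hp (he0 n) (he1 n)).trans ?_
    refine div_le_div_of_nonneg_right ?_ (by linarith)
    exact Real.rpow_le_rpow (by positivity) (by linarith [hMu2 x]) (by linarith)
  have hBj0 : 0 ≤ Bj := by positivity
  have hj0 : ∀ n x, x ∉ S → regPow p (e n) (u x) = 0 := fun n x hx => by simp [hu0 x hx, regPow]
  have hq0 : ∀ n x, x ∉ S → regPowQuot p (e n) (u x) = 0 := fun n x hx => by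
    simp [hu0 x hx, regPowQuot]
  have mu : Measurable u := hu.continuous.measurable
  have mj : ∀ n, Measurable fun x => regPow p (e n) (u x) := fun n =>
    ((contDiff_regPow (he0 n)).continuous.measurable).comp mu
  have mq : ∀ n, Measurable fun x => regPowQuot p (e n) (u x) := fun n => by
    unfold regPowQuot; fun_prop
  have mΔ : Measurable (Δ u) := hΔc.measurable
  -- the inequality with the regularized power
  have key : ∀ n, ∫ x, H (d x) * (regPow p (e n) (u x) * inner ℝ (∇ u x) (∇ d x)) ∂μ
      - α ^ 2 * ∫ x, A (d x) ^ 2 / ψ (d x) * regPowQuot p (e n) (u x) ∂μ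
      ≤ -∫ x, ψ (d x) * ((Δ u) x * regPow p (e n) (u x)) ∂μ := by
    intro n
    have hjC : ContDiff ℝ 1 (fun x => regPow p (e n) (u x)) := (contDiff_regPow (he0 n)).comp hu1
    have hjts : tsupport (fun x => regPow p (e n) (u x)) ⊆ S :=
      closure_minimal (fun x hx => by_contra fun h => hx (hj0 n x h)) (isClosed_tsupport u)
    have hjs : HasCompactSupport (fun x => regPow p (e n) (u x)) :=
      hSc.of_isClosed_subset (isClosed_tsupport _) hjts
    obtain ⟨Cj, hCj⟩ := ContDiff.lipschitzWith_of_hasCompactSupport hjs hjC (by norm_num)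
    have hSj : ∀ x ∈ tsupport (fun x => regPow p (e n) (u x)), d x ∈ Icc a b :=
      fun x hx => hS x (hjts hx)
    obtain ⟨Cw, hCw⟩ := exists_lipschitzWith_mul_comp hab hd hCj hjs hSj hψ hψ'
    have hws : HasCompactSupport fun x => regPow p (e n) (u x) * ψ (d x) := hjs.mul_right
    have hIBP := integral_laplacian_mul_eq_neg (μ := μ) hu hcu hCw hws
    have hgj : ∀ x, HasGradientAt (fun x => regPow p (e n) (u x))
        (regPowDeriv p (e n) (u x) • ∇ u x) x := fun x =>
      HasGradientAt.comp_real (hasDerivAt_regPow (u x) (he0 n))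
        ((hu1.differentiable (by norm_num)) x).hasGradientAt
    have hgw : ∀ᵐ x ∂μ, ∇ (fun x => regPow p (e n) (u x) * ψ (d x)) x
        = ψ (d x) • (regPowDeriv p (e n) (u x) • ∇ u x)
          + (regPow p (e n) (u x) * ψ' (d x)) • ∇ d x := by
      filter_upwards [hd.ae_hasGradientAt (μ := μ)] with x hx
      have h := hgj x
      rw [← h.gradient] at h
      rw [gradient_mul_comp h hx hSj hψ, (hgj x).gradient]
    have hL : ∫ x, ψ (d x) * ((Δ u) x * regPow p (e n) (u x)) ∂μ
        = ∫ x, (Δ u) x * (regPow p (e n) (u x) * ψ (d x)) ∂μ :=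
      integral_congr_ae (Eventually.of_forall fun x => by ring)
    rw [hL, hIBP, neg_neg, ← integral_const_mul, ← integral_sub]
    · refine integral_mono_ae ?_ ?_ ?_
      · refine Integrable.sub ?_ ?_
        · refine integrable_comp_mul hab hd.continuous hSc hS hHc (fun x hx => by simp [hj0 n x hx])
            (by have := mj n; fun_prop) (M := Bj * Cu) fun x => ?_
          rw [abs_mul]
          exact mul_le_mul (hBj n x) (hin x) (abs_nonneg _) hBj0
        · exact (integrable_comp_mul hab hd.continuous hSc hS hRc (hq0 n) (mq n)
            (hBq n)).const_mul _
      · refine integrable_of_bounded_of_compact (C := Cu * Cw) hSc ?_ (fun x hx => ?_)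
          (Eventually.of_forall fun x => ?_)
        · have := measurable_gradient (fun x => regPow p (e n) (u x) * ψ (d x))
          exact Measurable.aestronglyMeasurable (by fun_prop)
        · simp [gradient_of_notMem_tsupport hx]
        · refine (norm_inner_le_norm _ _).trans ?_
          exact mul_le_mul (hgu x) (norm_gradient_le_of_lipschitz hCw x) (norm_nonneg _) Cu.2
      · filter_upwards [hgw] with x hx
        simp only [hx]
        by_cases hxS : x ∈ S
        · have h1 := mul_inner_sub_le (G := ∇ u x) (A := A (d x)) (α := α) (hgd x)
            (hψ0 _ (hS x hxS)) (regPowDeriv_pos (u x) hp (he0 n))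
            (regPowQuot_mul_regPowDeriv (u x) hp (he0 n))
          rw [inner_add_right, inner_smul_right, inner_smul_right, inner_smul_right,
            real_inner_self_eq_norm_sq, hH]
          nlinarith
        · simp [hj0 n x hxS, hq0 n x hxS, gradient_of_notMem_tsupport hxS]
    · refine integrable_comp_mul hab hd.continuous hSc hS hHc (fun x hx => by simp [hj0 n x hx])
        (by have := mj n; fun_prop) (M := Bj * Cu) fun x => ?_
      rw [abs_mul]
      exact mul_le_mul (hBj n x) (hin x) (abs_nonneg _) hBj0
    · exact (integrable_comp_mul hab hd.continuous hSc hS hRc (hq0 n) (mq n) (hBq n)).const_mul _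
  have l1 := tendsto_integral_comp_mul (μ := μ) hab hd.continuous hSc hSm hS hHc
    (F := fun n x => regPow p (e n) (u x) * inner ℝ (∇ u x) (∇ d x))
    (fun n x hx => by simp [hj0 n x hx]) (fun n => by have := mj n; fun_prop) (M := Bj * Cu)
    (fun n x => by rw [abs_mul]; exact mul_le_mul (hBj n x) (hin x) (abs_nonneg _) hBj0)
    (fun x => (tendsto_regPow (p := p) (u x) he).mul_const _)
  have l2 := tendsto_integral_comp_mul (μ := μ) hab hd.continuous hSc hSm hS hRc
    (F := fun n x => regPowQuot p (e n) (u x)) hq0 mq hBq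
    (fun x => tendsto_regPowQuot (u x) hp he)
  have l3 := tendsto_integral_comp_mul (μ := μ) hab hd.continuous hSc hSm hS hψc
    (F := fun n x => (Δ u) x * regPow p (e n) (u x))
    (fun n x hx => by simp [hj0 n x hx]) (fun n => mΔ.mul (mj n)) (M := ML * Bj)
    (fun n x => by
      rw [abs_mul]
      exact mul_le_mul (hML x) (hBj n x) (abs_nonneg _) ((norm_nonneg _).trans (hML x)))
    (fun x => (tendsto_regPow (p := p) (u x) he).const_mul _)
  exact le_of_tendsto_of_tendsto' (l1.sub (l2.const_mul _)) l3.neg key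

end WeightedInequality

namespace Rellich

/-- The `L^p` inequality for the Laplacian obtained from a pair of one-variable functions `ψ`, `A`:
the test function is `|u|^{p-2} u ψ(d)`, the Hardy vector field is `(A / ψ)(d) ∇d`, and the
geometric hypothesis is applied to the function `-H(d) |u|^p / d`. -/
theorem integral_mul_le_integral_abs_laplacian_rpow {N : ℕ} {p k : ℝ} (hp : 1 < p)
    {U K : Set (EuclideanSpace ℝ (Fin N))} (hU : IsOpen U) (hgeom : DistanceLaplacianBound U K k)
    {u : EuclideanSpace ℝ (Fin N) → ℝ} (hu : IsTestFunction U u) {a b : ℝ} (ha : 0 < a)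
    (hab : a ≤ b) (hS : ∀ x ∈ tsupport u, Metric.infDist x K ∈ Icc a b) {ψ ψ' A H H' : ℝ → ℝ}
    (hψ : ∀ t ∈ Icc a b, HasDerivAt ψ (ψ' t) t) (hψ0 : ∀ t ∈ Icc a b, 0 < ψ t)
    (hψ' : ContinuousOn ψ' (Icc a b)) (hA : ContinuousOn A (Icc a b))
    (hH : ∀ t, H t = 2 * (2 * (p - 1) / p) * A t + ψ' t)
    (hHd : ∀ t ∈ Icc a b, HasDerivAt H (H' t) t) (hHneg : ∀ t ∈ Icc a b, H t ≤ 0)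
    (hH' : ContinuousOn H' (Icc a b)) (hH'0 : ∀ t ∈ Icc a b, 0 ≤ H' t) {R : ℝ → ℝ}
    (hRc : ContinuousOn R (Icc a b))
    (hR : ∀ t ∈ Icc a b, R t ≤ -(k - 1) * H t / t - H' t
      - 2 * (2 * (p - 1) / p) * (A t ^ 2 / ψ t) - (p - 1) * ψ t ^ (p / (p - 1))) :
    ∫ x, R (Metric.infDist x K) * |u x| ^ p ≤ ∫ x, |(Δ u) x| ^ p := by
  set d : EuclideanSpace ℝ (Fin N) → ℝ := fun x => Metric.infDist x K with hddef
  have hd : LipschitzWith 1 d := Metric.lipschitz_infDist_pt K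
  have hu2 : ContDiff ℝ 2 u := contDiff_infty.1 hu.contDiff 2
  have hu1 : ContDiff ℝ 1 u := hu2.of_le (by norm_num)
  have hp0 : 0 < p := by linarith
  have hp1 : 0 < p - 1 := by linarith
  set S := tsupport u with hSdef
  have hSc : IsCompact S := hu.hasCompactSupport
  have hu0 : ∀ x, x ∉ S → u x = 0 := fun x hx => image_eq_zero_of_notMem_tsupport hx
  have hψc : ContinuousOn ψ (Icc a b) := fun t ht => (hψ t ht).continuousAt.continuousWithinAt
  have hHc : ContinuousOn H (Icc a b) := fun t ht => (hHd t ht).continuousAt.continuousWithinAt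
  have htpos : ∀ t ∈ Icc a b, 0 < t := fun t ht => ha.trans_le ht.1
  have hAψ : ContinuousOn (fun t => A t ^ 2 / ψ t) (Icc a b) :=
    (hA.pow 2).div hψc fun t ht => (hψ0 t ht).ne'
  have hHt : ContinuousOn (fun t => -H t / t) (Icc a b) :=
    hHc.neg.div continuousOn_id fun t ht => (htpos t ht).ne'
  have hψp : ContinuousOn (fun t => ψ t ^ (p / (p - 1))) (Icc a b) :=
    hψc.rpow_const fun t ht => Or.inl (hψ0 t ht).ne'
  -- the function `|u|^p`
  set g : EuclideanSpace ℝ (Fin N) → ℝ := fun x => |u x| ^ p with hg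
  have hg0 : ∀ x, x ∉ S → g x = 0 := fun x hx => by simp [hg, hu0 x hx, Real.zero_rpow hp0.ne']
  have hgts : tsupport g ⊆ S :=
    closure_minimal (fun x hx => by_contra fun h => hx (hg0 x h)) (isClosed_tsupport u)
  have hgs : HasCompactSupport g := hSc.of_isClosed_subset (isClosed_tsupport _) hgts
  have hgC : ContDiff ℝ 1 g := hu1.norm_rpow hp
  obtain ⟨Cg, hCg⟩ := ContDiff.lipschitzWith_of_hasCompactSupport hgs hgC (by norm_num)
  obtain ⟨Mg, hMg⟩ := hgC.continuous.bounded_above_of_compact_support hgs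
  have hMg' : ∀ x, |g x| ≤ Mg := hMg
  have mg : Measurable g := hgC.continuous.measurable
  have hSg : ∀ x ∈ tsupport g, d x ∈ Icc a b := fun x hx => hS x (hgts hx)
  have hgg : ∀ x, HasGradientAt g ((p * |u x| ^ (p - 2) * u x) • ∇ u x) x := fun x =>
    HasGradientAt.comp_real (hasDerivAt_abs_rpow (u x) hp)
      ((hu1.differentiable (by norm_num)) x).hasGradientAt
  have mgd := measurable_gradient d
  have mgg := measurable_gradient g
  have hgd : ∀ x, ‖∇ d x‖ ≤ 1 := norm_gradient_le_of_lipschitz hd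
  have hin : ∀ x, |inner ℝ (∇ g x) (∇ d x)| ≤ (Cg : ℝ) := fun x =>
    (abs_real_inner_le_norm _ _).trans ((mul_le_of_le_one_right (norm_nonneg _) (hgd x)).trans
      (norm_gradient_le_of_lipschitz hCg x))
  have hint : ∀ {c : ℝ → ℝ}, ContinuousOn c (Icc a b) → Integrable (fun x => c (d x) * g x) :=
    fun {c} hc => integrable_comp_mul hab hd.continuous hSc hS hc hg0 mg hMg'
  have hintI : Integrable (fun x => H (d x) * inner ℝ (∇ g x) (∇ d x)) :=
    integrable_comp_mul hab hd.continuous hSc hS hHc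
      (fun x hx => by simp [gradient_of_notMem_tsupport fun h => hx (hgts h)])
      (by fun_prop) hin
  -- the geometric hypothesis
  have hII : (k - 1) * ∫ x, -H (d x) / d x * g x ≤
      (∫ x, H (d x) * inner ℝ (∇ g x) (∇ d x)) + ∫ x, H' (d x) * g x := by
    have hder : ∀ t ∈ Icc a b, HasDerivAt (fun t => -H t / t) ((-H' t * t - -H t * 1) / t ^ 2) t :=
      fun t ht => (hHd t ht).neg.div (hasDerivAt_id t) (htpos t ht).ne'
    have hder' : ContinuousOn (fun t => (-H' t * t - -H t * 1) / t ^ 2) (Icc a b) :=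
      ((hH'.neg.mul continuousOn_id).sub (hHc.neg.mul continuousOn_const)).div
        (continuousOn_id.pow 2) fun t ht => by have := htpos t ht; positivity
    obtain ⟨Cw, hCw⟩ := exists_lipschitzWith_mul_comp hab hd hCg hgs hSg hder hder'
    have hwts : tsupport (fun x => g x * (-H (d x) / d x)) ⊆ S :=
      (tsupport_mul_subset_left).trans hgts
    have h1 := hgeom.of_lipschitz hU hCw hgs.mul_right (hwts.trans hu.tsupport_subset) fun x => by
      by_cases hx : x ∈ S
      · have := hHneg _ (hS x hx)
        have := htpos _ (hS x hx)
        have : 0 ≤ g x := by positivity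
        have : 0 ≤ -H (d x) := by linarith
        positivity
      · simp [hg0 x hx]
    have e1 : ∫ x in U, g x * (-H (d x) / d x) = ∫ x, -H (d x) / d x * g x := by
      rw [setIntegral_eq_integral_of_forall_compl_eq_zero fun x hx => ?_]
      · exact integral_congr_ae (Eventually.of_forall fun x => mul_comm _ _)
      · simp [hg0 x fun h => hx (hu.tsupport_subset h)]
    have e2 : (fun x => d x * (g x * (-H (d x) / d x))) = fun x => g x * (fun t => -H t) (d x) := by
      funext x
      by_cases hx : x ∈ S
      · have : d x ≠ 0 := (htpos _ (hS x hx)).ne'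
        field_simp
      · simp [hg0 x hx]
    have hgr : ∀ᵐ x, ∇ (fun x => g x * (fun t => -H t) (d x)) x
        = (-H (d x)) • ∇ g x + (g x * -H' (d x)) • ∇ d x := by
      filter_upwards [hd.ae_hasGradientAt (μ := volume)] with x hx
      have := hgg x
      rw [← this.gradient] at this
      exact gradient_mul_comp this hx hSg (c := fun t => -H t) (c' := fun t => -H' t)
        fun t ht => (hHd t ht).neg
    have e3 : laplacianPairing U d (fun x => d x * (g x * (-H (d x) / d x)))
        = ∫ x, (H (d x) * inner ℝ (∇ g x) (∇ d x) + H' (d x) * (g x * ‖∇ d x‖ ^ 2)) := by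
      rw [laplacianPairing, e2, setIntegral_eq_integral_of_forall_compl_eq_zero fun x hx => ?_,
        ← integral_neg]
      · refine integral_congr_ae (hgr.mono fun x hx => ?_)
        simp only [hx]
        rw [inner_add_right, inner_smul_right, inner_smul_right, real_inner_self_eq_norm_sq,
          real_inner_comm]
        ring
      · have : x ∉ tsupport (fun x => g x * (fun t => -H t) (d x)) := fun h =>
          hx (hu.tsupport_subset (hgts (tsupport_mul_subset_left h)))
        rw [gradient_of_notMem_tsupport this, inner_zero_right]
    have hint2 : Integrable (fun x => H' (d x) * (g x * ‖∇ d x‖ ^ 2)) := by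
      refine integrable_comp_mul hab hd.continuous hSc hS hH' (fun x hx => by simp [hg0 x hx])
        (by fun_prop) (M := Mg) fun x => ?_
      rw [abs_mul, abs_of_nonneg (sq_nonneg ‖∇ d x‖)]
      exact (mul_le_of_le_one_right (abs_nonneg _)
        (pow_le_one₀ (norm_nonneg _) (hgd x))).trans (hMg' x)
    have h2 : ∫ x, H' (d x) * (g x * ‖∇ d x‖ ^ 2) ≤ ∫ x, H' (d x) * g x := by
      refine integral_mono hint2 (hint hH') fun x => ?_
      by_cases hx : x ∈ S
      · refine mul_le_mul_of_nonneg_left ?_ (hH'0 _ (hS x hx))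
        exact mul_le_of_le_one_right (by positivity) (pow_le_one₀ (norm_nonneg _) (hgd x))
      · simp [hg0 x hx]
    rw [e1, e3, integral_add hintI hint2] at h1
    linarith
  -- the inequality for `-Δ u` tested against `|u|^{p-2} u ψ(d)`
  have hI := integral_mul_inner_sub_le_neg_integral_laplacian volume hp hu2 hu.hasCompactSupport hd
    hab hS hψ hψ0 hψ' hA hH
  have e4 : ∫ x, H (d x) * (|u x| ^ (p - 2) * u x * inner ℝ (∇ u x) (∇ d x))
      = p⁻¹ * ∫ x, H (d x) * inner ℝ (∇ g x) (∇ d x) := by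
    rw [← integral_const_mul]
    refine integral_congr_ae (Eventually.of_forall fun x => ?_)
    simp only [(hgg x).gradient, real_inner_smul_left]
    field_simp
  have e5 : ∫ x, A (d x) ^ 2 / ψ (d x) * (|u x| ^ p / (p - 1))
      = (p - 1)⁻¹ * ∫ x, A (d x) ^ 2 / ψ (d x) * g x := by
    rw [← integral_const_mul]
    refine integral_congr_ae (Eventually.of_forall fun x => ?_)
    simp only [hg]
    field_simp
  rw [e4, e5] at hI
  -- Young's inequality
  have hΔc := continuous_laplacian hu2
  have hΔs : HasCompactSupport (Δ u) :=
    HasCompactSupport.intro hu.hasCompactSupport fun x hx => laplacian_of_notMem_tsupport hx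
  obtain ⟨ML, hML⟩ := hΔc.bounded_above_of_compact_support hΔs
  have hLp : Integrable (fun x => |(Δ u) x| ^ p) := by
    refine Continuous.integrable_of_hasCompactSupport
      (hΔc.abs.rpow_const fun x => Or.inr hp0.le) ?_
    exact HasCompactSupport.intro hu.hasCompactSupport fun x hx => by
      simp [laplacian_of_notMem_tsupport hx, Real.zero_rpow hp0.ne']
  have hj : ∀ x, |u x| ^ (p - 2) * u x = p⁻¹ * (p * |u x| ^ (p - 2) * u x) := fun x => by
    field_simp
  have hjc : Continuous fun x => |u x| ^ (p - 2) * u x := by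
    have h1 : Continuous (deriv fun s : ℝ => |s| ^ p) :=
      (contDiff_norm_rpow (E := ℝ) hp).continuous_deriv (by norm_num)
    have h2 : (deriv fun s : ℝ => |s| ^ p) = fun s => p * |s| ^ (p - 2) * s :=
      funext fun s => (hasDerivAt_abs_rpow s hp).deriv
    rw [h2] at h1
    simp_rw [hj]
    exact (h1.comp hu1.continuous).const_mul _
  have hjb : ∃ M, ∀ x, ‖(Δ u) x * (|u x| ^ (p - 2) * u x)‖ ≤ M :=
    (hΔc.mul hjc).bounded_above_of_compact_support hΔs.mul_right
  obtain ⟨M, hM⟩ := hjb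
  have hintL : Integrable (fun x => ψ (d x) * ((Δ u) x * (|u x| ^ (p - 2) * u x))) :=
    integrable_comp_mul hab hd.continuous hSc hS hψc
      (fun x hx => by simp [hu0 x hx]) (hΔc.mul hjc).measurable hM
  have hY : -(p * ∫ x, ψ (d x) * ((Δ u) x * (|u x| ^ (p - 2) * u x)))
      - (p - 1) * ∫ x, ψ (d x) ^ (p / (p - 1)) * g x ≤ ∫ x, |(Δ u) x| ^ p := by
    rw [← integral_const_mul, ← integral_neg, ← integral_const_mul, ← integral_sub]
    · refine integral_mono ?_ hLp fun x => ?_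
      · exact (hintL.const_mul p).neg.sub ((hint hψp).const_mul (p - 1))
      · by_cases hx : x ∈ S
        · have := neg_mul_sub_le_abs_rpow hp (hψ0 _ (hS x hx)) ((Δ u) x) (u x)
          simpa only [mul_assoc] using this
        · have : 0 ≤ |(Δ u) x| ^ p := by positivity
          simpa [hu0 x hx, hg0 x hx] using this
    · exact (hintL.const_mul p).neg
    · exact (hint hψp).const_mul (p - 1)
  -- collecting the terms
  have hfin : ∫ x, R (d x) * g x ≤ (k - 1) * (∫ x, -H (d x) / d x * g x) - (∫ x, H' (d x) * g x)
      - 2 * (2 * (p - 1) / p) * (∫ x, A (d x) ^ 2 / ψ (d x) * g x)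
      - (p - 1) * ∫ x, ψ (d x) ^ (p / (p - 1)) * g x := by
    have i1 := (hint hHt).const_mul (k - 1)
    have i2 := hint hH'
    have i3 := (hint hAψ).const_mul (2 * (2 * (p - 1) / p))
    have i4 := (hint hψp).const_mul (p - 1)
    have j2 : Integrable fun x => (k - 1) * (-H (d x) / d x * g x) - H' (d x) * g x := i1.sub i2
    have j3 : Integrable fun x => (k - 1) * (-H (d x) / d x * g x) - H' (d x) * g x
        - 2 * (2 * (p - 1) / p) * (A (d x) ^ 2 / ψ (d x) * g x) := j2.sub i3
    rw [← integral_const_mul, ← integral_const_mul, ← integral_const_mul, ← integral_sub i1 i2,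
      ← integral_sub j2 i3, ← integral_sub j3 i4]
    refine integral_mono (hint hRc) (j3.sub i4) fun x => ?_
    by_cases hx : x ∈ S
    · have h1 : 0 ≤ g x := by positivity
      have h2 := mul_le_mul_of_nonneg_right (hR _ (hS x hx)) h1
      refine h2.trans (le_of_eq ?_)
      ring
    · simp [hg0 x hx]
  refine hfin.trans ?_
  have h5 := mul_le_mul_of_nonneg_left hI hp0.le
  have e6 : p * (p⁻¹ * (∫ x, H (d x) * inner ℝ (∇ g x) (∇ d x))
      - (2 * (p - 1) / p) ^ 2 * ((p - 1)⁻¹ * ∫ x, A (d x) ^ 2 / ψ (d x) * g x))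
      = (∫ x, H (d x) * inner ℝ (∇ g x) (∇ d x))
        - 2 * (2 * (p - 1) / p) * ∫ x, A (d x) ^ 2 / ψ (d x) * g x := by
    field_simp
  rw [e6] at h5
  linarith

end Rellich

/-! ### Iterated logarithms -/

namespace Rellich

lemma X_mem_Ioo {t : ℝ} (ht : t ∈ Ioo (0 : ℝ) 1) (i : ℕ) : X i t ∈ Ioo (0 : ℝ) 1 := by
  induction i with
  | zero => exact ht
  | succ i ih =>
    have := Real.log_neg ih.1 ih.2
    exact ⟨inv_pos.2 (by linarith), inv_lt_one_of_one_lt₀ (by linarith)⟩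

lemma X_succ_eq_X_X_one (i : ℕ) (t : ℝ) : X (i + 1) t = X i (X 1 t) := by
  induction i with
  | zero => rfl
  | succ i ih =>
    rw [X, ih]
    rfl

/-- The product `X_1 ⋯ X_i`. -/
noncomputable def logProd (i : ℕ) (t : ℝ) : ℝ := ∏ j ∈ Finset.Icc 1 i, X j t

/-- The sum `η_m = X_1 + X_1 X_2 + ⋯ + X_1 ⋯ X_m`. -/
noncomputable def logSum (m : ℕ) (t : ℝ) : ℝ := ∑ i ∈ Finset.range m, logProd (i + 1) t

/-- The sum of squares `X_1² + X_1² X_2² + ⋯ + X_1² ⋯ X_m²`. -/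
noncomputable def logSqSum (m : ℕ) (t : ℝ) : ℝ := ∑ i ∈ Finset.range m, logProd (i + 1) t ^ 2

/-- The cubic sum `∑_{i ≤ m} (X_1 ⋯ X_i)² η_i`, which appears in the derivative of `logSqSum`. -/
noncomputable def logCubeSum (m : ℕ) (t : ℝ) : ℝ :=
  ∑ i ∈ Finset.range m, logProd (i + 1) t ^ 2 * logSum (i + 1) t

@[simp] lemma logProd_zero (t : ℝ) : logProd 0 t = 1 := by simp [logProd]

lemma logProd_succ (i : ℕ) (t : ℝ) : logProd (i + 1) t = logProd i t * X (i + 1) t := by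
  rw [logProd, Finset.prod_Icc_succ_top (by omega)]; rfl

lemma logProd_succ' (i : ℕ) (t : ℝ) : logProd (i + 1) t = X 1 t * logProd i (X 1 t) := by
  induction i with
  | zero => simp [logProd_succ]
  | succ i ih => rw [logProd_succ, ih, logProd_succ i, X_succ_eq_X_X_one (i + 1), mul_assoc]

lemma logSum_succ (m : ℕ) (t : ℝ) : logSum (m + 1) t = logSum m t + logProd (m + 1) t :=
  Finset.sum_range_succ _ _

lemma logSqSum_succ (m : ℕ) (t : ℝ) : logSqSum (m + 1) t = logSqSum m t + logProd (m + 1) t ^ 2 :=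
  Finset.sum_range_succ _ _

lemma logCubeSum_succ (m : ℕ) (t : ℝ) : logCubeSum (m + 1) t
    = logCubeSum m t + logProd (m + 1) t ^ 2 * logSum (m + 1) t :=
  Finset.sum_range_succ _ _

lemma logSum_succ' (m : ℕ) (t : ℝ) : logSum (m + 1) t = X 1 t * (1 + logSum m (X 1 t)) := by
  rw [logSum, Finset.sum_congr rfl fun i _ => logProd_succ' i t, ← Finset.mul_sum,
    Finset.sum_range_succ']
  simp [logSum, add_comm]

lemma logSqSum_nonneg (m : ℕ) (t : ℝ) : 0 ≤ logSqSum m t :=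
  Finset.sum_nonneg fun _ _ => sq_nonneg _

section Bounds

variable {t : ℝ}

lemma logProd_pos (ht : t ∈ Ioo (0 : ℝ) 1) (i : ℕ) : 0 < logProd i t :=
  Finset.prod_pos fun j _ => (X_mem_Ioo ht j).1

lemma logSum_nonneg (ht : t ∈ Ioo (0 : ℝ) 1) (m : ℕ) : 0 ≤ logSum m t :=
  Finset.sum_nonneg fun i _ => (logProd_pos ht (i + 1)).le

lemma logCubeSum_nonneg (ht : t ∈ Ioo (0 : ℝ) 1) (m : ℕ) : 0 ≤ logCubeSum m t :=
  Finset.sum_nonneg fun _ _ => mul_nonneg (sq_nonneg _) (logSum_nonneg ht _)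

lemma logSqSum_le (ht : t ∈ Ioo (0 : ℝ) 1) (m : ℕ) : logSqSum m t ≤ logSum m t ^ 2 := by
  induction m with
  | zero => simp [logSqSum, logSum]
  | succ m ih =>
    rw [logSqSum_succ, logSum_succ]
    nlinarith [mul_nonneg (logSum_nonneg ht m) (logProd_pos ht (m + 1)).le]

lemma logCubeSum_le (ht : t ∈ Ioo (0 : ℝ) 1) (m : ℕ) :
    logCubeSum m t ≤ logSum m t * logSqSum m t := by
  induction m with
  | zero => simp [logCubeSum, logSum]
  | succ m ih =>
    rw [logCubeSum_succ, logSqSum_succ, logSum_succ]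
    nlinarith [mul_nonneg (logProd_pos ht (m + 1)).le (logSqSum_nonneg m t)]

/-- A bound for `η_m` that is uniform in `m` and tends to `0` as `t → 0`. -/
lemma logSum_le (ht : t ∈ Ioo (0 : ℝ) 1) (m : ℕ) : logSum m t ≤ 2 / -Real.log t := by
  induction m generalizing t with
  | zero =>
    have := Real.log_neg ht.1 ht.2
    have : 0 < -Real.log t := by linarith
    simp only [logSum, Finset.range_zero, Finset.sum_empty]
    positivity
  | succ m ih =>
    have hL : 0 < -Real.log t := by linarith [Real.log_neg ht.1 ht.2]
    set L := -Real.log t with hLdef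
    have hX : X 1 t = (1 + L)⁻¹ := by simp [X, hLdef, sub_eq_add_neg]
    have hlog : -Real.log (X 1 t) = Real.log (1 + L) := by rw [hX, Real.log_inv, neg_neg]
    -- the induction step amounts to `2 L / (L + 2) ≤ log (1 + L)`
    have h1 := Real.le_log_one_add_of_nonneg hL.le
    have h0 : 0 < 2 * L / (L + 2) := by positivity
    have h2 := ih (X_mem_Ioo ht 1)
    rw [hlog] at h2
    have h3 : 2 / Real.log (1 + L) ≤ 2 / (2 * L / (L + 2)) :=
      div_le_div_of_nonneg_left (by norm_num) h0 h1
    rw [logSum_succ', hX]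
    calc (1 + L)⁻¹ * (1 + logSum m (X 1 t)) ≤ (1 + L)⁻¹ * (1 + 2 / (2 * L / (L + 2))) := by
          gcongr
          exact h2.trans h3
      _ = 2 / L := by field_simp; ring

/-- For small `t` the first term dominates `η_m`, so that `η_m²` is controlled by the sum of the
squares of its terms. -/
lemma sq_logSum_le (ht : t ∈ Ioo (0 : ℝ) 1) (hsmall : Real.exp 2 ≤ -Real.log t) (m : ℕ) :
    logSum m t ^ 2 ≤ 4 * logSqSum m t := by
  cases m with
  | zero => simp [logSum, logSqSum]
  | succ m =>
    have hX := X_mem_Ioo ht 1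
    have h1 := logSum_le hX m
    have hlog : 2 ≤ -Real.log (X 1 t) := by
      have : -Real.log (X 1 t) = Real.log (1 - Real.log t) := by simp [X]
      rw [this, Real.le_log_iff_exp_le (by linarith [Real.exp_pos 2])]
      linarith
    have h2 : logSum m (X 1 t) ≤ 1 := h1.trans ((div_le_one (by linarith)).2 hlog)
    have h3 : logSum (m + 1) t ≤ 2 * X 1 t := by
      rw [logSum_succ']; nlinarith [hX.1]
    have h4 : X 1 t ^ 2 ≤ logSqSum (m + 1) t := by
      have : logProd (0 + 1) t ^ 2 = X 1 t ^ 2 := by simp [logProd]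
      rw [← this]
      exact Finset.single_le_sum (f := fun i => logProd (i + 1) t ^ 2)
        (fun _ _ => sq_nonneg _) (Finset.mem_range.2 (Nat.succ_pos m))
    calc logSum (m + 1) t ^ 2 ≤ (2 * X 1 t) ^ 2 :=
          pow_le_pow_left₀ (logSum_nonneg ht _) h3 2
      _ ≤ _ := by linarith

lemma hasDerivAt_X (ht : t ∈ Ioo (0 : ℝ) 1) (i : ℕ) :
    HasDerivAt (X i) (X i t * logProd i t / t) t := by
  have h0 := ht.1.ne'
  induction i with
  | zero =>
    refine (hasDerivAt_id t).congr_deriv ?_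
    simp [X, h0]
  | succ i ih =>
    have hx := X_mem_Ioo ht i
    have hl := Real.log_neg hx.1 hx.2
    have h1 := ((ih.log hx.1.ne').const_sub 1).inv (by linarith)
    refine h1.congr_deriv ?_
    have hx0 := hx.1.ne'
    rw [logProd_succ, X]
    field_simp

lemma hasDerivAt_logProd (ht : t ∈ Ioo (0 : ℝ) 1) (i : ℕ) :
    HasDerivAt (logProd i) (logProd i t * logSum i t / t) t := by
  induction i with
  | zero =>
    have : logProd 0 = fun _ => 1 := funext logProd_zero
    rw [this]
    simpa [logSum] using hasDerivAt_const t (1 : ℝ)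
  | succ i ih =>
    have : logProd (i + 1) = fun s => logProd i s * X (i + 1) s := funext (logProd_succ i)
    rw [this]
    refine (ih.mul (hasDerivAt_X ht (i + 1))).congr_deriv ?_
    rw [logSum_succ, logProd_succ]
    ring

lemma hasDerivAt_logSum (ht : t ∈ Ioo (0 : ℝ) 1) (m : ℕ) :
    HasDerivAt (logSum m) ((logSum m t ^ 2 + logSqSum m t) / 2 / t) t := by
  induction m with
  | zero =>
    have : logSum 0 = fun _ => 0 := by funext s; simp [logSum]
    rw [this]
    simpa [logSqSum] using hasDerivAt_const t (0 : ℝ)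
  | succ m ih =>
    have : logSum (m + 1) = fun s => logSum m s + logProd (m + 1) s := funext (logSum_succ m)
    rw [this]
    refine (ih.add (hasDerivAt_logProd ht (m + 1))).congr_deriv ?_
    simp only [logSum_succ, logSqSum_succ]
    ring

lemma hasDerivAt_logSqSum (ht : t ∈ Ioo (0 : ℝ) 1) (m : ℕ) :
    HasDerivAt (logSqSum m) (2 * logCubeSum m t / t) t := by
  induction m with
  | zero =>
    have : logSqSum 0 = fun _ => 0 := by funext s; simp [logSqSum]
    rw [this]
    simpa [logCubeSum] using hasDerivAt_const t (0 : ℝ)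
  | succ m ih =>
    have : logSqSum (m + 1) = fun s => logSqSum m s + logProd (m + 1) s ^ 2 :=
      funext (logSqSum_succ m)
    rw [this]
    refine (ih.add ((hasDerivAt_logProd ht (m + 1)).pow 2)).congr_deriv ?_
    simp only [logCubeSum_succ]
    ring

lemma continuousAt_logCubeSum (ht : t ∈ Ioo (0 : ℝ) 1) (m : ℕ) : ContinuousAt (logCubeSum m) t := by
  unfold logCubeSum
  refine tendsto_finsetSum _ fun i _ => ?_
  exact (((hasDerivAt_logProd ht (i + 1)).continuousAt.pow 2).mul
    (hasDerivAt_logSum ht (i + 1)).continuousAt)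

end Bounds

end Rellich

/-! ### Expansion of the potential -/

/-- The binomial expansion to second order, with a cubic remainder. -/
lemma exists_one_add_rpow_le (q : ℝ) : ∃ r > 0, ∃ C, 0 ≤ C ∧ ∀ x : ℝ, |x| ≤ r →
    (1 + x) ^ q ≤ 1 + q * x + q * (q - 1) / 2 * x ^ 2 + C * |x| ^ 3 := by
  have h := (Real.one_add_rpow_hasFPowerSeriesAt_zero (a := q)).isBigO_sub_partialSum_pow 3
  obtain ⟨C, hC0, hC⟩ := h.exists_nonneg
  rw [Asymptotics.isBigOWith_iff] at hC
  obtain ⟨ε, hε, hball⟩ := Metric.eventually_nhds_iff.1 hC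
  have h2 : Ring.choose q 2 = q * (q - 1) / 2 := by
    have h := Ring.descPochhammer_eq_factorial_smul_choose q 2
    simp [descPochhammer, Polynomial.smeval_mul, Polynomial.smeval_sub] at h
    linarith
  refine ⟨ε / 2, by positivity, C, hC0, fun x hx => ?_⟩
  have h3 := hball (y := x) (by rw [dist_zero_right, Real.norm_eq_abs]; linarith)
  simp only [FormalMultilinearSeries.partialSum, Finset.sum_range_succ, Finset.sum_range_zero,
    binomialSeries_apply, Ring.choose_zero_right, Ring.choose_one_right, h2, zero_add,
    Real.norm_eq_abs, List.ofFn_const, List.prod_replicate, smul_eq_mul, pow_zero, pow_one,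
    abs_pow, abs_abs] at h3
  linarith [(abs_le.1 h3).2]

namespace Rellich

/-- The coefficient `T` in `H = -Q^{p-1} t^{1-2p} T`, as a function of `y = η_m(t/D)` and
`b = ∑ (X_1 ⋯ X_i)²(t/D)`. The parameter `α` stands for `2 (p - 1) / p`. -/
noncomputable def fluxCoeff (p a₀ α β a₂ y b : ℝ) : ℝ :=
  2 * α * (a₀ * (1 + β * y) + y / 2 + a₂ * y ^ 2) + (2 * p - 2) * (1 + β * y)
    - β / 2 * (y ^ 2 + b)

/-- The scaled derivative `t T'(t)` of `fluxCoeff`, given `t y' = (y² + b) / 2` and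
`t b' = 2 c`. -/
noncomputable def fluxCoeffDeriv (p a₀ α β a₂ y b c : ℝ) : ℝ :=
  2 * α * (a₀ * β + 1 / 2 + 2 * a₂ * y) * ((y ^ 2 + b) / 2) + (2 * p - 2) * β * ((y ^ 2 + b) / 2)
    - β / 2 * (y * (y ^ 2 + b) + 2 * c)

section Algebra

variable {p a₀ α β lam κ Q q a₂ y b c ρ C : ℝ}

/-- Expansion of the potential up to third order. The terms of order one cancel for every choice of
`a₂` and `β`; the coefficient of `y²` vanishes because `β = κ / λ`. -/
lemma add_mul_add_cubic_le (hq : (p - 1) * q = p)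
    (h₁ : 2 * α * a₀ ^ 2 + 2 * a₀ * (2 * p - 2) = p * Q)
    (h₂ : (p - 1) * Q * (q * (q - 1) / 2) = lam) (h₃ : κ = α * a₀ + (p - 1) - a₀)
    (h₄ : lam * β = κ) (hα : 0 ≤ α) (hQ : 0 ≤ Q) (hp : 1 < p) (hy : 0 ≤ y)
    (hx : |β * y| ≤ 1 / 2)
    (hρ : ρ ≤ 1 + q * (β * y) + q * (q - 1) / 2 * (β * y) ^ 2 + C * y ^ 3) :
    Q + (α / 2 + κ * β) * b
      + (2 * α * a₂ * (y * (y ^ 2 + b)) - β / 2 * (y ^ 3 + y * b + 2 * c)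
        - 2 * α * (y / 2 + a₂ * y ^ 2) ^ 2 * (1 + 2 * |β| * y) + α * y ^ 2 / 2
        - (p - 1) * Q * C * y ^ 3)
    ≤ 2 * a₀ * fluxCoeff p a₀ α β a₂ y b + fluxCoeffDeriv p a₀ α β a₂ y b c
      - 2 * α * ((a₀ * (1 + β * y) + y / 2 + a₂ * y ^ 2) ^ 2 / (1 + β * y))
      - (p - 1) * Q * ρ := by
  unfold fluxCoeff fluxCoeffDeriv
  have hx' := abs_le.1 hx
  have hpos : 0 < 1 + β * y := by linarith
  set z := y / 2 + a₂ * y ^ 2 with hz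
  have e1 : (a₀ * (1 + β * y) + y / 2 + a₂ * y ^ 2) ^ 2 / (1 + β * y)
      = a₀ ^ 2 * (1 + β * y) + 2 * a₀ * z + z ^ 2 / (1 + β * y) := by
    rw [show a₀ * (1 + β * y) + y / 2 + a₂ * y ^ 2 = a₀ * (1 + β * y) + z by rw [hz]; ring]
    field_simp
    ring
  have e2 : z ^ 2 / (1 + β * y) ≤ z ^ 2 * (1 + 2 * |β| * y) := by
    rw [div_le_iff₀ hpos, mul_assoc]
    refine le_mul_of_one_le_right (sq_nonneg z) ?_
    have : |β * y| = |β| * y := by rw [abs_mul, abs_of_nonneg hy]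
    rw [mul_assoc 2, ← this]
    nlinarith [abs_nonneg (β * y), neg_abs_le (β * y)]
  have e3 := mul_le_mul_of_nonneg_left e2 (by linarith : 0 ≤ 2 * α)
  have e4 := mul_le_mul_of_nonneg_left hρ (mul_nonneg (by linarith : 0 ≤ p - 1) hQ)
  rw [e1]
  have : 2 * a₀ * (2 * α * (a₀ * (1 + β * y) + y / 2 + a₂ * y ^ 2) + (2 * p - 2) * (1 + β * y)
        - β / 2 * (y ^ 2 + b))
      + (2 * α * (a₀ * β + 1 / 2 + 2 * a₂ * y) * ((y ^ 2 + b) / 2)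
        + (2 * p - 2) * β * ((y ^ 2 + b) / 2) - β / 2 * (y * (y ^ 2 + b) + 2 * c))
      - 2 * α * (a₀ ^ 2 * (1 + β * y) + 2 * a₀ * z + z ^ 2 * (1 + 2 * |β| * y))
      - (p - 1) * Q * (1 + q * (β * y) + q * (q - 1) / 2 * (β * y) ^ 2 + C * y ^ 3)
    = Q + (α / 2 + κ * β) * b
      + (2 * α * a₂ * (y * (y ^ 2 + b)) - β / 2 * (y ^ 3 + y * b + 2 * c)
        - 2 * α * z ^ 2 * (1 + 2 * |β| * y) + α * y ^ 2 / 2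
        - (p - 1) * Q * C * y ^ 3) := by
    rw [hz]
    linear_combination (-Q * β * y) * hq + (1 + β * y) * h₁ - β ^ 2 * y ^ 2 * h₂
      - β * (y ^ 2 + b) * h₃ - β * y ^ 2 * h₄
  linarith

/-- The cubic terms are nonnegative for small `y` once `a₂` is large, since `y b` controls `y³`. -/
lemma cubic_terms_nonneg (hα : 0 < α) (hC : 0 ≤ C)
    (ha₂ : α * a₂ / 2 = 2 * |β| + α * |β| + C + 1)
    (hy : 0 ≤ y) (hy1 : y ≤ 1)
    (hyK : (2 * α * a₂ ^ 2 + 4 * α * |β| * a₂ + 4 * α * |β| * a₂ ^ 2) * y ≤ 1)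
    (hb : y ^ 2 ≤ 4 * b) (hb' : b ≤ y ^ 2) (hc : 0 ≤ c) (hc' : c ≤ y * b) :
    0 ≤ 2 * α * a₂ * (y * (y ^ 2 + b)) - β / 2 * (y ^ 3 + y * b + 2 * c)
        - 2 * α * (y / 2 + a₂ * y ^ 2) ^ 2 * (1 + 2 * |β| * y) + α * y ^ 2 / 2 - C * y ^ 3 := by
  have hβ := abs_nonneg β
  have hαa : 0 ≤ α * a₂ := by nlinarith [mul_nonneg hα.le hβ]
  have hyb : y ^ 3 / 4 ≤ y * b := by nlinarith
  have hyb' : y * b ≤ y ^ 3 := by nlinarith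
  have hb0 : 0 ≤ b := by nlinarith [sq_nonneg y]
  have h1 : β / 2 * (y ^ 3 + y * b + 2 * c) ≤ 2 * |β| * y ^ 3 := by
    have h0 : 0 ≤ y ^ 3 + y * b + 2 * c := by positivity
    have : β / 2 * (y ^ 3 + y * b + 2 * c) ≤ |β| / 2 * (y ^ 3 + y * b + 2 * c) :=
      mul_le_mul_of_nonneg_right (by linarith [le_abs_self β]) h0
    have h2 : |β| / 2 * (y ^ 3 + y * b + 2 * c) ≤ |β| / 2 * (4 * y ^ 3) :=
      mul_le_mul_of_nonneg_left (by linarith) (by positivity)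
    linarith
  have h2 : α * a₂ * (y ^ 3 / 4) ≤ α * a₂ * (y * b) := mul_le_mul_of_nonneg_left hyb hαa
  have h3 : 0 ≤ y ^ 3 := by positivity
  have h4 := mul_le_mul_of_nonneg_left hyK h3
  have h5 : 4 * α * |β| * a₂ ^ 2 * y ^ 5 ≤ 4 * α * |β| * a₂ ^ 2 * y ^ 4 :=
    mul_le_mul_of_nonneg_left (pow_le_pow_of_le_one hy hy1 (by norm_num)) (by positivity)
  have h6 : α * a₂ / 2 * y ^ 3 = (2 * |β| + α * |β| + C + 1) * y ^ 3 := by rw [ha₂]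
  nlinarith

/-- For a suitable `a₂` the one-variable inequalities needed for the construction hold as long as
`y` is small. -/
lemma exists_profile (hq : (p - 1) * q = p)
    (h₁ : 2 * α * a₀ ^ 2 + 2 * a₀ * (2 * p - 2) = p * Q)
    (h₂ : (p - 1) * Q * (q * (q - 1) / 2) = lam) (h₃ : κ = α * a₀ + (p - 1) - a₀)
    (h₄ : lam * β = κ) (hα : 0 < α) (ha₀ : 0 < a₀) (hQ : 0 ≤ Q) (hp : 1 < p) :
    ∃ a₂ y₀ : ℝ, 0 < y₀ ∧ ∀ y b c : ℝ, 0 ≤ y → y ≤ y₀ → y ^ 2 ≤ 4 * b → b ≤ y ^ 2 → 0 ≤ c →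
      c ≤ y * b → 0 < 1 + β * y ∧ 0 ≤ fluxCoeff p a₀ α β a₂ y b ∧
        fluxCoeffDeriv p a₀ α β a₂ y b c ≤ (2 * p - 1) * fluxCoeff p a₀ α β a₂ y b ∧
        Q + (α / 2 + κ * β) * b ≤ 2 * a₀ * fluxCoeff p a₀ α β a₂ y b
          + fluxCoeffDeriv p a₀ α β a₂ y b c
          - 2 * α * ((a₀ * (1 + β * y) + y / 2 + a₂ * y ^ 2) ^ 2 / (1 + β * y))
          - (p - 1) * Q * (1 + β * y) ^ q := by
  obtain ⟨r, hr, C₀, hC₀, hexp⟩ := exists_one_add_rpow_le q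
  have hβ := abs_nonneg β
  set C := (p - 1) * Q * (C₀ * |β| ^ 3) with hCdef
  have hp1 : 0 < p - 1 := by linarith
  have hC : 0 ≤ C := by positivity
  set a₂ := 2 * (2 * |β| + α * |β| + C + 1) / α with ha₂def
  have ha₂ : α * a₂ / 2 = 2 * |β| + α * |β| + C + 1 := by rw [ha₂def]; field_simp
  have ha₂0 : 0 < a₂ := by positivity
  -- `K₁` controls the terms of order four; `K₂`, `K₃` are Lipschitz constants of `T` and `t T'` at
  -- `y = 0`, where `T = T₀ > 0` and `t T' = 0`
  set K₁ := 2 * α * a₂ ^ 2 + 4 * α * |β| * a₂ + 4 * α * |β| * a₂ ^ 2 with hK₁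
  set K₂ := 2 * α * a₀ * |β| + (2 * p - 2) * |β| + |β| with hK₂
  set K₃ := 2 * α * (a₀ * |β| + 1 / 2 + 2 * a₂) + (2 * p - 2) * |β| + 2 * |β| with hK₃
  have hp2 : 0 < 2 * p - 2 := by linarith
  set T₀ := 2 * α * a₀ + (2 * p - 2) with hT₀
  have hT₀pos : 0 < T₀ := by positivity
  have hK₁0 : 0 ≤ K₁ := by positivity
  have hK₂0 : 0 ≤ K₂ := by positivity
  have hK₃0 : 0 ≤ K₃ := by positivity
  refine ⟨a₂, min 1 (min (min r (1 / 2) / (|β| + 1)) (min (1 / (K₁ + 1))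
    (T₀ / 2 / (K₂ + K₃ + 1)))), by positivity, ?_⟩
  intro y b c hy hyy hb hb' hc hc'
  simp only [le_min_iff] at hyy
  obtain ⟨hy1, hy2, hy3, hy4⟩ := hyy
  rw [le_div_iff₀ (by positivity)] at hy2 hy3 hy4
  have hb0 : 0 ≤ b := by linarith [sq_nonneg y]
  have habs : |β * y| = |β| * y := by rw [abs_mul, abs_of_nonneg hy]
  have hyβ : |β * y| ≤ min r (1 / 2) := by rw [habs]; linarith
  have hyr : |β * y| ≤ r := hyβ.trans (min_le_left _ _)
  have hyh : |β * y| ≤ 1 / 2 := hyβ.trans (min_le_right _ _)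
  have hβy := abs_le.1 hyh
  have hyy1 : y ^ 2 ≤ y := pow_le_of_le_one hy hy1 two_ne_zero
  have hββ := abs_le.1 (le_refl |β|)
  have hT : T₀ - K₂ * y ≤ fluxCoeff p a₀ α β a₂ y b := by
    have h1 : β / 2 * (y ^ 2 + b) ≤ |β| * y := by
      have : β / 2 * (y ^ 2 + b) ≤ |β| / 2 * (y ^ 2 + b) :=
        mul_le_mul_of_nonneg_right (by linarith) (by positivity)
      have h2 : |β| / 2 * (y ^ 2 + b) ≤ |β| / 2 * (2 * y) :=
        mul_le_mul_of_nonneg_left (by linarith) (by positivity)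
      linarith
    have h2 : -(|β| * y) ≤ β * y := habs ▸ neg_abs_le (β * y)
    have h3 : 0 ≤ 2 * α * (y / 2 + a₂ * y ^ 2) := by positivity
    have h4 : 2 * α * a₀ * -(|β| * y) ≤ 2 * α * a₀ * (β * y) :=
      mul_le_mul_of_nonneg_left h2 (by positivity)
    have h5 : (2 * p - 2) * -(|β| * y) ≤ (2 * p - 2) * (β * y) :=
      mul_le_mul_of_nonneg_left h2 hp2.le
    unfold fluxCoeff
    rw [hT₀, hK₂]
    linarith
  have hT' : fluxCoeffDeriv p a₀ α β a₂ y b c ≤ K₃ * y := by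
    have hs : (y ^ 2 + b) / 2 ≤ y := by linarith
    have hs0 : 0 ≤ (y ^ 2 + b) / 2 := by positivity
    have h1 : 2 * α * (a₀ * β + 1 / 2 + 2 * a₂ * y) ≤ 2 * α * (a₀ * |β| + 1 / 2 + 2 * a₂) := by
      have : a₀ * β ≤ a₀ * |β| := mul_le_mul_of_nonneg_left hββ.2 ha₀.le
      have : a₂ * y ≤ a₂ := mul_le_of_le_one_right ha₂0.le hy1
      exact mul_le_mul_of_nonneg_left (by linarith) (by positivity)
    have h2 : 2 * α * (a₀ * β + 1 / 2 + 2 * a₂ * y) * ((y ^ 2 + b) / 2)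
        ≤ 2 * α * (a₀ * |β| + 1 / 2 + 2 * a₂) * y :=
      mul_le_mul h1 hs hs0 (by positivity)
    have h3 : (2 * p - 2) * β * ((y ^ 2 + b) / 2) ≤ (2 * p - 2) * |β| * y :=
      mul_le_mul (mul_le_mul_of_nonneg_left hββ.2 hp2.le) hs hs0 (by positivity)
    have h4 : -(β / 2 * (y * (y ^ 2 + b) + 2 * c)) ≤ 2 * |β| * y := by
      have h0 : 0 ≤ y * (y ^ 2 + b) + 2 * c := by positivity
      have h5 : -(β / 2) * (y * (y ^ 2 + b) + 2 * c) ≤ |β| / 2 * (y * (y ^ 2 + b) + 2 * c) :=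
        mul_le_mul_of_nonneg_right (by linarith [neg_abs_le β]) h0
      have h6 : y * b ≤ y := mul_le_of_le_one_right hy (by linarith)
      have h7 : y * y ^ 2 ≤ y := mul_le_of_le_one_right hy (by linarith)
      have h8 : |β| / 2 * (y * (y ^ 2 + b) + 2 * c) ≤ |β| / 2 * (4 * y) :=
        mul_le_mul_of_nonneg_left (by linarith) (by positivity)
      linarith
    unfold fluxCoeffDeriv
    rw [hK₃]
    linarith
  have hsum : K₂ * y + K₃ * y ≤ T₀ / 2 := by linarith
  have hK₂y : 0 ≤ K₂ * y := by positivity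
  have hK₃y : 0 ≤ K₃ * y := by positivity
  have hTpos : T₀ / 2 ≤ fluxCoeff p a₀ α β a₂ y b := by linarith
  refine ⟨by linarith, by linarith, ?_, ?_⟩
  · have : 1 * fluxCoeff p a₀ α β a₂ y b ≤ (2 * p - 1) * fluxCoeff p a₀ α β a₂ y b :=
      mul_le_mul_of_nonneg_right (by linarith) (by linarith)
    linarith
  · have hρ : (1 + β * y) ^ q
        ≤ 1 + q * (β * y) + q * (q - 1) / 2 * (β * y) ^ 2 + C₀ * |β| ^ 3 * y ^ 3 := by
      have := hexp _ hyr
      rwa [habs, mul_pow |β|, ← mul_assoc C₀] at this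
    have h := add_mul_add_cubic_le (a₂ := a₂) (b := b) (c := c) hq h₁ h₂ h₃ h₄ hα.le hQ hp hy hyh hρ
    have hcub := cubic_terms_nonneg (c := c) hα hC ha₂ hy hy1 (by linarith) hb hb' hc hc'
    have : (p - 1) * Q * (C₀ * |β| ^ 3) * y ^ 3 = C * y ^ 3 := by rw [hCdef]
    linarith

end Algebra

end Rellich

/-! ### Choice of the one-variable functions -/

namespace Rellich

lemma Q_pos {p k : ℝ} (hp : 1 < p) (hk : 2 * p < k) : 0 < Q p k := by
  have h1 : 0 < p - 1 := by linarith
  have h2 : 0 < k - 2 * p := by linarith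
  have h3 : 0 < k := by linarith
  unfold Q
  positivity

lemma G_pos {p k : ℝ} (hp : 1 < p) (hk : 2 * p < k) : 0 < G p k := by
  have h1 : 0 < p - 1 := by linarith
  have h2 : 0 < k - 2 * p := by linarith
  have h3 := abs_pos.2 (Q_pos hp hk).ne'
  unfold G
  positivity

/-- A positive distance is bounded away from zero on a compact set. -/
lemma exists_forall_infDist_mem_Icc {E : Type*} [PseudoMetricSpace E] {S K : Set E}
    (hS : IsCompact S) {b : ℝ} (hb : 0 < b)
    (h : ∀ x ∈ S, 0 < Metric.infDist x K ∧ Metric.infDist x K ≤ b) :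
    ∃ a, 0 < a ∧ a ≤ b ∧ ∀ x ∈ S, Metric.infDist x K ∈ Icc a b := by
  rcases S.eq_empty_or_nonempty with rfl | hne
  · exact ⟨b, hb, le_rfl, by simp⟩
  · obtain ⟨x₀, hx₀, hmin⟩ := hS.exists_isMinOn hne (Metric.continuous_infDist_pt K).continuousOn
    exact ⟨Metric.infDist x₀ K, (h x₀ hx₀).1, (h x₀ hx₀).2, fun x hx => ⟨hmin hx, (h x hx).2⟩⟩

/-- The one-variable functions satisfy the required inequalities below a threshold `D e^{-Λ}`, where
`Λ` depends neither on `D` nor on the number `m` of logarithmic terms. -/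
theorem exists_forall_integral_le {p k : ℝ} (hp : 1 < p) (hk : 2 * p < k) :
    ∃ Λ : ℝ, 0 < Λ ∧ ∀ (N : ℕ) (U K : Set (EuclideanSpace ℝ (Fin N))), IsOpen U →
      DistanceLaplacianBound U K k → ∀ u, IsTestFunction U u → ∀ D : ℝ, 0 < D →
      (∀ x ∈ tsupport u, 0 < Metric.infDist x K ∧ Metric.infDist x K ≤ D * Real.exp (-Λ)) →
      ∀ m : ℕ, ∫ x, (Q p k ^ p + G p k * logSqSum m (Metric.infDist x K / D))
        / Metric.infDist x K ^ (2 * p) * |u x| ^ p ≤ ∫ x, |(Δ u) x| ^ p := by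
  have hp1 : 0 < p - 1 := by linarith
  have hp0 : 0 < p := by linarith
  have hk2 : 0 < k - 2 * p := by linarith
  have hk0 : 0 < k := by linarith
  have hQ := Q_pos hp hk
  set α := 2 * (p - 1) / p with hα
  set a₀ := (k - 2 * p) / 2 with ha₀
  set lam := k * (k - 2 * p) / (2 * p) with hlam
  set κ := α * a₀ + (p - 1) - a₀ with hκ
  -- the value of `β` for which the coefficient of `η²` in the expansion is zero
  set β := κ / lam with hβ
  set q := p / (p - 1) with hqdef
  have hα0 : 0 < α := by positivity
  have ha₀0 : 0 < a₀ := by positivity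
  have hlam0 : 0 < lam := by positivity
  have hq : (p - 1) * q = p := by rw [hqdef]; field_simp
  have h₁ : 2 * α * a₀ ^ 2 + 2 * a₀ * (2 * p - 2) = p * Q p k := by
    rw [hα, ha₀, Q]; field_simp; ring
  have h₂ : (p - 1) * Q p k * (q * (q - 1) / 2) = lam := by
    have : q - 1 = 1 / (p - 1) := by rw [hqdef]; field_simp; ring
    rw [this, hqdef, Q, hlam]; field_simp
  have h₄ : lam * β = κ := by rw [hβ]; field_simp
  have hG : G p k = Q p k ^ (p - 1) * (α / 2 + κ * β) := by
    have e1 : Q p k ^ (p - 1) = Q p k ^ (p - 2) * Q p k := by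
      rw [← Real.rpow_add_one hQ.ne']; congr 1; ring
    rw [G, abs_of_pos hQ, e1]
    have : (p - 1) / (2 * p ^ 3) * (k ^ 2 * (p - 1) ^ 2 + (k - 2 * p) ^ 2)
        = Q p k * (α / 2 + κ * β) := by
      have e2 : Q p k = α * lam := by rw [Q, hα, hlam]; field_simp
      have e3 : Q p k * (α / 2 + κ * β) = α * (α * lam / 2 + κ ^ 2) := by
        rw [e2, ← h₄]; ring
      rw [e3, hκ, hlam, hα, ha₀]; field_simp; ring
    linear_combination Q p k ^ (p - 2) * this
  obtain ⟨a₂, y₀, hy₀, hprof⟩ := exists_profile hq h₁ h₂ hκ h₄ hα0 ha₀0 hQ.le hp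
  -- `exp 2` makes the first logarithmic term dominant, `2 / y₀` makes `η_m ≤ y₀`
  refine ⟨max (Real.exp 2) (2 / y₀), lt_max_of_lt_left (Real.exp_pos 2), ?_⟩
  set Λ := max (Real.exp 2) (2 / y₀) with hΛ
  have hΛ0 : 0 < Λ := lt_max_of_lt_left (Real.exp_pos 2)
  intro N U K hU hgeom u hu D hD hsupp m
  set b := D * Real.exp (-Λ) with hb
  have hb0 : 0 < b := by positivity
  obtain ⟨a, ha, hab, hS⟩ :=
    exists_forall_infDist_mem_Icc hu.hasCompactSupport.isCompact hb0 hsupp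
  have htpos : ∀ t ∈ Icc a b, 0 < t := fun t ht => ha.trans_le ht.1
  have hlog : ∀ t ∈ Icc a b, Λ ≤ -Real.log (t / D) := by
    intro t ht
    have h1 : t / D ≤ Real.exp (-Λ) := by rw [div_le_iff₀ hD, mul_comm]; exact ht.2
    have h2 := Real.log_le_log (div_pos (htpos t ht) hD) h1
    rw [Real.log_exp] at h2
    linarith
  have htD : ∀ t ∈ Icc a b, t / D ∈ Ioo (0 : ℝ) 1 := fun t ht => by
    have h0 := div_pos (htpos t ht) hD
    refine ⟨h0, ?_⟩
    rw [← Real.log_neg_iff h0]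
    linarith [hlog t ht]
  set y : ℝ → ℝ := fun t => logSum m (t / D) with hy
  set bb : ℝ → ℝ := fun t => logSqSum m (t / D) with hbb
  set cc : ℝ → ℝ := fun t => logCubeSum m (t / D) with hcc
  -- the smallness of `η_m`, uniformly in `m`
  have hsmall : ∀ t ∈ Icc a b, 0 < 1 + β * y t ∧ 0 ≤ fluxCoeff p a₀ α β a₂ (y t) (bb t) ∧
      fluxCoeffDeriv p a₀ α β a₂ (y t) (bb t) (cc t)
        ≤ (2 * p - 1) * fluxCoeff p a₀ α β a₂ (y t) (bb t) ∧
      Q p k + (α / 2 + κ * β) * bb t ≤ 2 * a₀ * fluxCoeff p a₀ α β a₂ (y t) (bb t)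
        + fluxCoeffDeriv p a₀ α β a₂ (y t) (bb t) (cc t)
        - 2 * α * ((a₀ * (1 + β * y t) + y t / 2 + a₂ * y t ^ 2) ^ 2 / (1 + β * y t))
        - (p - 1) * Q p k * (1 + β * y t) ^ q := by
    intro t ht
    have h := htD t ht
    have hl := hlog t ht
    refine hprof _ _ _ (logSum_nonneg h m) ?_
      (sq_logSum_le h ((le_max_left _ _).trans hl) m) (logSqSum_le h m)
      (logCubeSum_nonneg h m) (logCubeSum_le h m)
    refine (logSum_le h m).trans ?_
    have h2 : 2 / y₀ ≤ -Real.log (t / D) := (le_max_right _ _).trans hl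
    rw [div_le_iff₀ hy₀] at h2
    rw [div_le_iff₀ (by linarith)]
    linarith
  have hdiv : ∀ t, HasDerivAt (fun t => t / D) (1 / D) t := fun t => (hasDerivAt_id t).div_const D
  have hyd : ∀ t ∈ Icc a b, HasDerivAt y ((y t ^ 2 + bb t) / 2 / t) t := by
    intro t ht
    have ht0 := (htpos t ht).ne'
    refine ((hasDerivAt_logSum (htD t ht) m).comp t (hdiv t)).congr_deriv ?_
    simp only [hy, hbb]
    field_simp
  have hbd : ∀ t ∈ Icc a b, HasDerivAt bb (2 * cc t / t) t := by
    intro t ht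
    have ht0 := (htpos t ht).ne'
    refine ((hasDerivAt_logSqSum (htD t ht) m).comp t (hdiv t)).congr_deriv ?_
    simp only [hcc]
    field_simp
  have hyc : ContinuousOn y (Icc a b) := fun t ht => (hyd t ht).continuousAt.continuousWithinAt
  have hbc : ContinuousOn bb (Icc a b) := fun t ht => (hbd t ht).continuousAt.continuousWithinAt
  have hccc : ContinuousOn cc (Icc a b) := fun t ht =>
    ((continuousAt_logCubeSum (htD t ht) m).comp (f := fun t => t / D)
      (hdiv t).continuousAt).continuousWithinAt
  have hpow : ∀ r : ℝ, ContinuousOn (fun t : ℝ => t ^ r) (Icc a b) := fun r =>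
    continuousOn_id.rpow_const fun t ht => Or.inl (htpos t ht).ne'
  set Z := Q p k ^ (p - 1) with hZ
  have hZ0 : 0 < Z := Real.rpow_pos_of_pos hQ _
  have hTd : ∀ t ∈ Icc a b, HasDerivAt (fun t => fluxCoeff p a₀ α β a₂ (y t) (bb t))
      (fluxCoeffDeriv p a₀ α β a₂ (y t) (bb t) (cc t) / t) t := by
    intro t ht
    have h1 := hyd t ht
    have h2 := hbd t ht
    have hl := (h1.const_mul β).const_add 1
    have := (((((hl.const_mul a₀).add (h1.div_const 2)).add ((h1.pow 2).const_mul a₂)).const_mul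
      (2 * α)).add (hl.const_mul (2 * p - 2))).sub (((h1.pow 2).add h2).const_mul (β / 2))
    refine this.congr_deriv ?_
    unfold fluxCoeffDeriv
    have ht0 := (htpos t ht).ne'
    field_simp
    ring
  refine integral_mul_le_integral_abs_laplacian_rpow hp hU hgeom hu ha hab hS
    (R := fun t => (Q p k ^ p + G p k * bb t) / t ^ (2 * p))
    (ψ := fun t => Z * t ^ (2 - 2 * p) * (1 + β * y t))
    (ψ' := fun t => Z * t ^ (1 - 2 * p) * ((2 - 2 * p) * (1 + β * y t)
      + β * ((y t ^ 2 + bb t) / 2)))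
    (A := fun t => -(Z * t ^ (1 - 2 * p) * (a₀ * (1 + β * y t) + y t / 2 + a₂ * y t ^ 2)))
    (H := fun t => -(Z * t ^ (1 - 2 * p) * fluxCoeff p a₀ α β a₂ (y t) (bb t)))
    (H' := fun t => Z * t ^ (-(2 * p)) * ((2 * p - 1) * fluxCoeff p a₀ α β a₂ (y t) (bb t)
      - fluxCoeffDeriv p a₀ α β a₂ (y t) (bb t) (cc t)))
    ?_ ?_ ?_ ?_ ?_ ?_ ?_ ?_ ?_ ?_ ?_
  · intro t ht
    have ht0 := htpos t ht
    have e : t ^ (2 - 2 * p) = t ^ (1 - 2 * p) * t := by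
      rw [← Real.rpow_add_one ht0.ne']; congr 1; ring
    have h1 := (Real.hasDerivAt_rpow_const (p := 2 - 2 * p) (Or.inl ht0.ne')).const_mul Z
    refine (h1.mul (((hyd t ht).const_mul β).const_add 1)).congr_deriv ?_
    rw [show 2 - 2 * p - 1 = 1 - 2 * p by ring, e]
    field_simp
  · intro t ht
    exact mul_pos (mul_pos hZ0 (Real.rpow_pos_of_pos (htpos t ht) _)) (hsmall t ht).1
  · have := hpow (1 - 2 * p)
    fun_prop
  · have := hpow (1 - 2 * p)
    fun_prop
  · intro t
    simp only [fluxCoeff]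
    ring
  · intro t ht
    have ht0 := htpos t ht
    have e : t ^ (1 - 2 * p) = t ^ (-(2 * p)) * t := by
      rw [← Real.rpow_add_one ht0.ne']; congr 1; ring
    have h1 := (Real.hasDerivAt_rpow_const (p := 1 - 2 * p) (Or.inl ht0.ne')).const_mul Z
    refine (h1.mul (hTd t ht)).neg.congr_deriv ?_
    rw [show 1 - 2 * p - 1 = -(2 * p) by ring, e]
    field_simp
    ring
  · intro t ht
    have h1 := Real.rpow_pos_of_pos (htpos t ht) (1 - 2 * p)
    have h2 := (hsmall t ht).2.1
    exact neg_nonpos.2 (by positivity)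
  · have := hpow (-(2 * p))
    simp only [fluxCoeff, fluxCoeffDeriv]
    fun_prop
  · intro t ht
    have h1 := Real.rpow_pos_of_pos (htpos t ht) (-(2 * p))
    have h2 := (hsmall t ht).2.2.1
    exact mul_nonneg (by positivity) (by linarith)
  · exact (continuousOn_const.add (continuousOn_const.mul hbc)).div (hpow (2 * p))
      fun t ht => (Real.rpow_pos_of_pos (htpos t ht) _).ne'
  · intro t ht
    have ht0 := htpos t ht
    obtain ⟨hpos, -, -, hE⟩ := hsmall t ht
    set T := fluxCoeff p a₀ α β a₂ (y t) (bb t) with hT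
    set T' := fluxCoeffDeriv p a₀ α β a₂ (y t) (bb t) (cc t) with hT'
    set n := a₀ * (1 + β * y t) + y t / 2 + a₂ * y t ^ 2 with hn
    set w := t ^ (-(2 * p)) with hw
    have hw0 : 0 < w := Real.rpow_pos_of_pos ht0 _
    have e1 : t ^ (1 - 2 * p) = w * t := by
      rw [hw, ← Real.rpow_add_one ht0.ne']; congr 1; ring
    have e2 : t ^ (2 - 2 * p) = w * t ^ 2 := by
      rw [hw, ← Real.rpow_natCast, ← Real.rpow_add ht0]; congr 1; push_cast; ring
    have e3 : (t ^ (2 * p))⁻¹ = w := by rw [hw, Real.rpow_neg ht0.le]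
    have e4 : Q p k ^ p = Z * Q p k := by
      rw [hZ, ← Real.rpow_add_one hQ.ne']; congr 1; ring
    have e5 : (Z * t ^ (2 - 2 * p) * (1 + β * y t)) ^ q = Z * Q p k * w * (1 + β * y t) ^ q := by
      have ht2 : 0 ≤ t ^ (2 - 2 * p) := (Real.rpow_pos_of_pos ht0 _).le
      rw [Real.mul_rpow (mul_nonneg hZ0.le ht2) hpos.le, Real.mul_rpow hZ0.le ht2, hZ,
        ← Real.rpow_mul hQ.le, ← Real.rpow_mul ht0.le, hq, e4, hw]
      congr 3
      linear_combination (-2) * hq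
    have e6 : (-(Z * (w * t) * n)) ^ 2 / (Z * (w * t ^ 2) * (1 + β * y t))
        = Z * w * (n ^ 2 / (1 + β * y t)) := by
      field_simp
    have e7 : -(k - 1) * -(Z * (w * t) * T) / t = (k - 1) * (Z * w * T) := by
      field_simp
    rw [e5, e1, e2, e6, e7, div_eq_mul_inv, e3, e4, hG]
    have h := mul_le_mul_of_nonneg_left hE (mul_pos hZ0 hw0).le
    have hk' : k = 2 * a₀ + 2 * p := by rw [ha₀]; ring
    calc (Z * Q p k + Z * (α / 2 + κ * β) * bb t) * w
        = Z * w * (Q p k + (α / 2 + κ * β) * bb t) := by ring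
      _ ≤ _ := h
      _ = _ := by rw [hk']; ring

end Rellich

/-! ### Passage to the infinite series -/

namespace Rellich

lemma logTerm_nonneg {N : ℕ} (Ω K : Set (EuclideanSpace ℝ (Fin N))) (p D : ℝ)
    (u : EuclideanSpace ℝ (Fin N) → ℝ) (i : ℕ) : 0 ≤ logTerm Ω K p D u i := by
  refine integral_nonneg fun x => ?_
  have : 0 ≤ Metric.infDist x K := Metric.infDist_nonneg
  exact mul_nonneg (by positivity) (Finset.prod_nonneg fun j _ => sq_nonneg _)

/-- The potential with `m` logarithmic terms integrates to the corresponding sum of `logTerm`s. -/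
lemma integral_potential_eq {N : ℕ} {p c₁ c₂ D : ℝ} (hp : 1 < p)
    {Ω K : Set (EuclideanSpace ℝ (Fin N))} {u : EuclideanSpace ℝ (Fin N) → ℝ}
    (hu : IsTestFunction (Ω \ K) u)
    (hsupp : ∀ x ∈ tsupport u, 0 < Metric.infDist x K) (hD : 0 < D)
    (hD' : ∀ x ∈ tsupport u, Metric.infDist x K / D < 1) (m : ℕ) :
    ∫ x, (c₁ + c₂ * logSqSum m (Metric.infDist x K / D)) / Metric.infDist x K ^ (2 * p) * |u x| ^ p
      = c₁ * (∫ x in Ω, |u x| ^ p / Metric.infDist x K ^ (2 * p))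
        + c₂ * ∑ i ∈ Finset.range m, logTerm Ω K p D u (i + 1) := by
  have hp0 : p ≠ 0 := by linarith
  have hu0 : ∀ x, x ∉ tsupport u → |u x| ^ p = 0 := fun x hx => by
    rw [image_eq_zero_of_notMem_tsupport hx, abs_zero, Real.zero_rpow hp0]
  have huΩ : ∀ x, x ∉ Ω → |u x| ^ p = 0 := fun x hx =>
    hu0 x fun h => hx (hu.tsupport_subset h).1
  have hcont : Continuous fun x => |u x| ^ p :=
    (hu.contDiff.continuous.abs).rpow_const fun x => Or.inr (by linarith)
  obtain ⟨M, hM⟩ := hcont.bounded_above_of_compact_support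
    (HasCompactSupport.intro hu.hasCompactSupport hu0)
  -- `d` attains its supremum on the compact support, so this supremum is less than `D`
  obtain ⟨b, hb0, hbD, hb⟩ : ∃ b, 0 < b ∧ b < D ∧ ∀ x ∈ tsupport u, Metric.infDist x K ≤ b := by
    rcases (tsupport u).eq_empty_or_nonempty with he | hne
    · exact ⟨D / 2, by positivity, by linarith, by simp [he]⟩
    · obtain ⟨x₀, hx₀, hmax⟩ := hu.hasCompactSupport.isCompact.exists_isMaxOn hne
        (Metric.continuous_infDist_pt K).continuousOn
      exact ⟨_, hsupp x₀ hx₀, (div_lt_one hD).1 (hD' x₀ hx₀), fun x hx => hmax hx⟩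
  obtain ⟨a, ha, hab, hS⟩ := exists_forall_infDist_mem_Icc hu.hasCompactSupport.isCompact hb0
    fun x hx => ⟨hsupp x hx, hb x hx⟩
  have hint : ∀ {c : ℝ → ℝ}, ContinuousOn c (Icc a b) →
      Integrable fun x => c (Metric.infDist x K) * |u x| ^ p := fun hc =>
    integrable_comp_mul hab (Metric.continuous_infDist_pt K) hu.hasCompactSupport hS hc hu0
      hcont.measurable hM
  have htpos : ∀ t ∈ Icc a b, 0 < t := fun t ht => ha.trans_le ht.1
  have hpow : ContinuousOn (fun t : ℝ => (t ^ (2 * p))⁻¹) (Icc a b) :=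
    (continuousOn_id.rpow_const fun t ht => Or.inl (htpos t ht).ne').inv₀
      fun t ht => (Real.rpow_pos_of_pos (htpos t ht) _).ne'
  have hlogProd : ∀ i, ContinuousOn (fun t => logProd i (t / D) ^ 2) (Icc a b) := by
    intro i t ht
    have h1 : t / D ∈ Ioo (0 : ℝ) 1 :=
      ⟨div_pos (htpos t ht) hD, (div_lt_one hD).2 (ht.2.trans_lt hbD)⟩
    have h2 := ((hasDerivAt_logProd h1 i).continuousAt).comp (f := fun t => t / D)
      (continuousAt_id.div_const D)
    exact (h2.pow 2).continuousWithinAt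
  have i₀ := hint hpow
  have i₁ : ∀ i, Integrable fun x => (Metric.infDist x K ^ (2 * p))⁻¹
      * logProd (i + 1) (Metric.infDist x K / D) ^ 2 * |u x| ^ p :=
    fun i => hint (hpow.mul (hlogProd (i + 1)))
  have e₀ : ∫ x in Ω, |u x| ^ p / Metric.infDist x K ^ (2 * p)
      = ∫ x, (Metric.infDist x K ^ (2 * p))⁻¹ * |u x| ^ p := by
    rw [setIntegral_eq_integral_of_forall_compl_eq_zero fun x hx => by simp [huΩ x hx]]
    exact integral_congr_ae (Eventually.of_forall fun x => by ring)
  have e₁ : ∀ i, logTerm Ω K p D u (i + 1) = ∫ x, (Metric.infDist x K ^ (2 * p))⁻¹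
      * logProd (i + 1) (Metric.infDist x K / D) ^ 2 * |u x| ^ p := by
    intro i
    rw [logTerm, setIntegral_eq_integral_of_forall_compl_eq_zero fun x hx => by simp [huΩ x hx]]
    refine integral_congr_ae (Eventually.of_forall fun x => ?_)
    simp only [Finset.prod_pow, logProd]
    ring
  simp_rw [e₀, e₁]
  rw [← integral_finsetSum _ fun i _ => i₁ i, ← integral_const_mul, ← integral_const_mul,
    ← integral_add (i₀.const_mul _) ((integrable_finsetSum _ fun i _ => i₁ i).const_mul _)]
  refine integral_congr_ae (Eventually.of_forall fun x => ?_)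
  simp only [logSqSum, ← Finset.sum_mul, ← Finset.mul_sum]
  ring

end Rellich

theorem theorem2 (N : ℕ) (hN : 2 ≤ N) (p k : ℝ) (hp : 1 < p) (hk : 2 * p < k)
    (Ω : Set (EuclideanSpace ℝ (Fin N))) (hΩ : IsOpen Ω) (hΩc : IsConnected Ω)
    (K : Set (EuclideanSpace ℝ (Fin N))) (hK : IsClosed K) (hKne : K.Nonempty)
    (hd : BddAbove ((fun x => Metric.infDist x K) '' Ω))
    (hgeom : Rellich.DistanceLaplacianBound (Ω \ K) K k) :
    ∃ D₀ : ℝ, 0 < D₀ ∧ (∀ x ∈ Ω, Metric.infDist x K ≤ D₀) ∧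
      ∀ D : ℝ, D₀ ≤ D → ∀ u : EuclideanSpace ℝ (Fin N) → ℝ,
        Rellich.IsTestFunction (Ω \ K) u →
          Summable (fun i : ℕ => Rellich.logTerm Ω K p D u (i + 1)) ∧
          Rellich.Q p k ^ p * (∫ x in Ω, |u x| ^ p / Metric.infDist x K ^ (2 * p))
              + Rellich.G p k * ∑' i : ℕ, Rellich.logTerm Ω K p D u (i + 1)
            ≤ ∫ x in Ω, |(Δ u) x| ^ p := by
  obtain ⟨Λ, hΛ, hmain⟩ := Rellich.exists_forall_integral_le hp hk
  obtain ⟨s, hs⟩ := hd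
  have hs' : ∀ x ∈ Ω, Metric.infDist x K ≤ max 1 s := fun x hx =>
    (hs (mem_image_of_mem _ hx)).trans (le_max_right _ _)
  have hs0 : 0 < max 1 s := lt_max_of_lt_left one_pos
  have hexp : 1 ≤ Real.exp Λ := Real.one_le_exp hΛ.le
  -- the factor `exp Λ` ensures `d ≤ D exp (-Λ)` on `Ω` for all `D ≥ D₀`
  refine ⟨max 1 s * Real.exp Λ, by positivity,
    fun x hx => (hs' x hx).trans (le_mul_of_one_le_right hs0.le hexp), fun D hD u hu => ?_⟩
  have hD0 : 0 < D := lt_of_lt_of_le (by positivity) hD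
  have hsD : max 1 s ≤ D * Real.exp (-Λ) := by
    rw [Real.exp_neg, ← div_eq_mul_inv, le_div_iff₀ (Real.exp_pos Λ)]
    exact hD
  have hsupp : ∀ x ∈ tsupport u, 0 < Metric.infDist x K ∧
      Metric.infDist x K ≤ D * Real.exp (-Λ) := fun x hx =>
    ⟨(hK.notMem_iff_infDist_pos hKne).1 (hu.tsupport_subset hx).2,
      (hs' x (hu.tsupport_subset hx).1).trans hsD⟩
  have hlt : ∀ x ∈ tsupport u, Metric.infDist x K / D < 1 := fun x hx => by
    rw [div_lt_one hD0]
    refine (hsupp x hx).2.trans_lt (mul_lt_of_lt_one_right hD0 ?_)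
    rw [Real.exp_lt_one_iff]
    linarith
  have hLap : ∫ x in Ω, |(Δ u) x| ^ p = ∫ x, |(Δ u) x| ^ p :=
    setIntegral_eq_integral_of_forall_compl_eq_zero fun x hx => by
      rw [laplacian_of_notMem_tsupport fun h => hx (hu.tsupport_subset h).1, abs_zero,
        Real.zero_rpow (by linarith)]
  have hG := Rellich.G_pos hp hk
  have hpart : ∀ m, ∑ i ∈ Finset.range m, Rellich.logTerm Ω K p D u (i + 1)
      ≤ ((∫ x in Ω, |(Δ u) x| ^ p)
        - Rellich.Q p k ^ p * ∫ x in Ω, |u x| ^ p / Metric.infDist x K ^ (2 * p))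
        / Rellich.G p k := by
    intro m
    have h := hmain N (Ω \ K) K (hΩ.sdiff hK) hgeom u hu D hD0 hsupp m
    rw [Rellich.integral_potential_eq hp hu (fun x hx => (hsupp x hx).1) hD0 hlt] at h
    rw [le_div_iff₀ hG, hLap]
    linarith
  have hnn := fun i => Rellich.logTerm_nonneg Ω K p D u (i + 1)
  refine ⟨summable_of_sum_range_le hnn hpart, ?_⟩
  have h := Real.tsum_le_of_sum_range_le hnn hpart
  rw [le_div_iff₀ hG] at h
  linarith
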